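/- **Setting.** Let $C,A_1,\dots,A_m\in\mathbb S^n$ and $b\in\mathbb R^m$. Consider the semidefinite program (P): minimize $\langle C,X\rangle$ subject to $\langle A_i,X\rangle=b_i$ $(1\le i\le m)$, $X\succeq 0$; and its dual (D): maximize $b^{\mathsf T}y$ subject to $Z+\sum_i y_iA_i=C$, $Z\succeq0$. Assume that the $A_i$ are linearly independent, that (P) and (D) are both strictly feasible, and that strict complementarity holds: there are a primal optimal $X^\star$ and a dual optimal $(y^\star,Z^\star)$ with $\operatorname{rank}X^\star+\operatorname{rank}Z^\star=n$. Let $\mathcal P^\star$ be the set of optimal solutions of (P), $\mathcal X_0=\{X\in\mathbb S^n:\langle A_i,X\rangle=b_i\ \forall i\}$, $\mathcal A(X)=(\langle A_i,X\rangle)_i$, $\mathcal A^*(y)=\sum_i y_iA_i$, let $\|\cdot\|$ be the Frobenius norm, and $\lambda_1\ge\lambda_2\ge\dots\ge\lambda_n$ the ordered eigenvalues of a symmetric matrix. Let $$F(X)=\langle C,X\rangle+\rho\max\{\lambda_{1}(-X),0\},\qquad \rho>\max\{\operatorname{tr}Z^\star:(y^\star,Z^\star)\text{ dual optimal}\},$$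 $$\sigma_{\mathrm p}=\max_{X^\star\in\mathcal P^\star}\dim\operatorname{null}(X^\star),\qquad \delta=\inf_{X^\star\in\mathcal P^\star}\ \sup_{1\le r\le\sigma_{\mathrm p}}\bigl(\lambda_r(-X^\star)-\lambda_{r+1}(-X^\star)\bigr),$$ where $\delta:=0$ if $\sigma_{\mathrm p}=0$, and $\lambda_{n+1}:=0$. **Algorithm.** Let $r_{\mathrm p}\ge0$, $r_{\mathrm c}\ge1$, $r=r_{\mathrm p}+r_{\mathrm c}<n$, $\alpha>0$, $\beta\in(0,1)$, $\Omega_0\in\mathbb S^n$. For $\bar W\in\mathbb S^n$ and $P\in\mathbb R^{n\times r}$ put $$\hat F_{(\bar W,P)}(X)=\langle C,X\rangle+\rho\max_{S\succeq0,\ \gamma\ge0,\ \gamma+\operatorname{tr}S\le1}\langle\gamma\bar W+PSP^{\mathsf T},-X\rangle .$$ Start with any $\bar W_0\succeq0$, $\operatorname{tr}\bar W_0=1$, and with $P_0$ whose columns are orthonormal eigenvectors for the $r$ largest eigenvalues of $-\Omega_0$; put $X_0^\star=\Omega_0$. At iteration $t\ge 0$: 1. Let $X_{t+1}^\star$ minimize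 $\hat F_{(\bar W_t,P_t)}(X)+\frac\alpha2\|X-\Omega_t\|^2$ over $\mathcal X_0$. Let $W_t^\star=\gamma_t^\star\bar W_t+P_tS_t^\star P_t^{\mathsf T}$ (with $S_t^\star\succeq0$, $\gamma^\star_t\ge0$, $\gamma_t^\star+\operatorname{tr}S_t^\star\le\rho$) together with $y_t^\star$ minimize the dual form of this problem, $\langle W-C,\Omega_t\rangle-\langle b-\mathcal A(\Omega_t),y\rangle+\frac1{2\alpha}\|W-C+\mathcal A^*(y)\|^2$, over all $y\in\mathbb R^m$ and all $W$ of the form $\gamma\bar W_t+P_tSP_t^{\mathsf T}$ with $S\succeq0$, $\gamma\ge0$, $\gamma+\operatorname{tr}S\le\rho$. 2. If $t=0$ and $\Omega_0\notin\mathcal X_0$, put $\Omega_1=X_1^\star$. Otherwise put $\Omega_{t+1}=X^\star_{t+1}$ (descent step) if $\beta\bigl(F(\Omega_t)-\hat F_{(\bar W_t,P_t)}(X_{t+1}^\star)\bigr)\le F(\Omega_t)-F(X^\star_{t+1})$, and $\Omega_{t+1}=\Omega_t$ (null step) if not. 3. Let $V_t$ have as columns orthonormal eigenvectors for the $r_{\mathrm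 c}$ largest eigenvalues of $-X_{t+1}^\star$. Let $[Q_1\ Q_2]$ be an orthogonal matrix of eigenvectors of $S_t^\star$, eigenvalues in decreasing order, $Q_1$ consisting of the first $r_{\mathrm p}$ columns, and let $\Sigma_2$ be the diagonal matrix of the last $r_{\mathrm c}$ eigenvalues. Let $P_{t+1}\in\mathbb R^{n\times r}$ have orthonormal columns whose span contains the columns of $V_t$ and of $P_tQ_1$. Put $\bar W_{t+1}=(\gamma^\star_t\bar W_t+P_tQ_2\Sigma_2Q_2^{\mathsf T}P_t^{\mathsf T})/(\gamma_t^\star+\operatorname{tr}\Sigma_2)$; if the denominator is $0$, take any $\bar W_{t+1}\succeq0$ with $\operatorname{tr}\bar W_{t+1}=1$. All choices left open are arbitrary; a sequence so produced is called a run. **Lemma.** There is a constant $\eta>0$, depending only on the problem data and $\rho$, with the following properties. (a) If $\delta>0$, then $$\eta=4\rho\max\Bigl\{\frac{144\,\sup_{X^\star\in\mathcal P^\star}\|X^\star\|_{\mathrm{op}}}{\delta^2},\ \frac{9(8\sqrt2+16)}{\delta}\Bigr\};$$ and $\delta>0$ whenever $C\notin\operatorname{span}\{A_1,\dots,A_m\}$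 and $\sigma_{\mathrm p}<n$. (b) For all $r_{\mathrm p},r_{\mathrm c},\alpha,\beta,\Omega_0$ as above with $r_{\mathrm c}\ge\sigma_{\mathrm p}$ there is $T_0\ge1$ such that for every run and every $t\ge T_0$: - if $\delta>0$, then $\|\Omega_t-X^\star\|_{\mathrm{op}}\le\delta/3$ for some $X^\star\in\mathcal P^\star$; - $\hat F_{(\bar W_t,P_t)}(X)\le F(X)$ for all $X\in\mathcal X_0$; - if $\alpha\ge\eta$ and $\beta\le\frac12$, or if $\Omega_t=X_t^\star$ (for instance, if iteration $t-1$ was a descent step), then $$F(X)\le\hat F_{(\bar W_t,P_t)}(X)+\frac\eta2\|X-\Omega_t\|^2\qquad\text{for all }X\in\mathcal X_0 .$$ -/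

import Mathlib

open Matrix

noncomputable section

namespace SBMP

/-- Trace inner product of real matrices. -/
def innerF {p q : ℕ} (M N : Matrix (Fin p) (Fin q) ℝ) : ℝ := (Mᵀ * N).trace

/-- Squared Frobenius norm. -/
def normSqF {p q : ℕ} (M : Matrix (Fin p) (Fin q) ℝ) : ℝ := innerF M M

/-- Operator (spectral) norm, induced by the Euclidean norm. -/
def opNorm {p : ℕ} (M : Matrix (Fin p) (Fin p) ℝ) : ℝ :=
  ‖Matrix.toEuclideanCLM (n := Fin p) (𝕜 := ℝ) M‖

/-- `lam M k` is the `k`-th largest eigenvalue (counted from `1`, with multiplicity) of a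
symmetric matrix `M` of size `p`; the value is only meaningful for `1 ≤ k ≤ p`. -/
def lam {p : ℕ} (M : Matrix (Fin p) (Fin p) ℝ) (k : ℕ) : ℝ :=
  open Classical in
  if h : M.IsHermitian ∧ 1 ≤ k ∧ k ≤ p then
    h.1.eigenvalues₀ ⟨k - 1, by rw [Fintype.card_fin]; omega⟩
  else 0

/-- The columns of `V` are orthonormal eigenvectors of `M` for its `k` largest eigenvalues,
in decreasing order. -/
def IsTopEigenvectors {p k : ℕ} (M : Matrix (Fin p) (Fin p) ℝ)
    (V : Matrix (Fin p) (Fin k) ℝ) : Prop :=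
  Vᵀ * V = 1 ∧ M * V = V * Matrix.diagonal (fun j : Fin k => lam M ((j : ℕ) + 1))

/-- Data of a standard-form semidefinite program: minimize `⟨C, X⟩` subject to
`⟨A i, X⟩ = b i` and `X ⪰ 0`. -/
structure SDP (n m : ℕ) where
  C : Matrix (Fin n) (Fin n) ℝ
  A : Fin m → Matrix (Fin n) (Fin n) ℝ
  b : Fin m → ℝ
  C_symm : C.IsSymm
  A_symm : ∀ i, (A i).IsSymm

namespace SDP

variable {n m : ℕ} (D : SDP n m)

/-- The affine set of symmetric matrices with `⟨A i, X⟩ = b i` for all `i`. -/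
def affineSet : Set (Matrix (Fin n) (Fin n) ℝ) :=
  {X | X.IsSymm ∧ ∀ i, innerF (D.A i) X = D.b i}

/-- The adjoint map `y ↦ ∑ i, y i • A i`. -/
def adj (y : Fin m → ℝ) : Matrix (Fin n) (Fin n) ℝ := ∑ i, y i • D.A i

/-- Primal optimal solutions. -/
def primalOpt : Set (Matrix (Fin n) (Fin n) ℝ) :=
  {X | (X ∈ D.affineSet ∧ X.PosSemidef) ∧
    ∀ X' ∈ D.affineSet, X'.PosSemidef → innerF D.C X ≤ innerF D.C X'}

/-- Dual optimal solutions: maximize `bᵀ y` subject to `Z + ∑ i, y i • A i = C`, `Z ⪰ 0`. -/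
def dualOpt : Set ((Fin m → ℝ) × Matrix (Fin n) (Fin n) ℝ) :=
  {p | (p.2 + D.adj p.1 = D.C ∧ p.2.PosSemidef) ∧
    ∀ (y' : Fin m → ℝ) (Z' : Matrix (Fin n) (Fin n) ℝ),
      Z' + D.adj y' = D.C → Z'.PosSemidef → D.b ⬝ᵥ y' ≤ D.b ⬝ᵥ p.1}

/-- Both the primal and the dual program are strictly feasible. -/
def Slater : Prop :=
  (∃ X ∈ D.affineSet, X.PosDef) ∧
    ∃ (y : Fin m → ℝ) (Z : Matrix (Fin n) (Fin n) ℝ), Z + D.adj y = D.C ∧ Z.PosDef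

/-- Some pair of primal and dual optimal solutions satisfies `rank X + rank Z = n`. -/
def StrictComplementarity : Prop :=
  ∃ X ∈ D.primalOpt, ∃ p ∈ D.dualOpt, X.rank + p.2.rank = n

/-- The largest trace of a dual optimal `Z`. -/
def dualTraceMax : ℝ := sSup ((fun p => p.2.trace) '' D.dualOpt)

/-- `σ_p`: the largest dimension of the null space of a primal optimal solution. -/
def sigmaP : ℕ :=
  sSup ((fun X : Matrix (Fin n) (Fin n) ℝ =>
    Module.finrank ℝ (LinearMap.ker X.mulVecLin)) '' D.primalOpt)

/-- The eigenvalue gap parameter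
`inf_{X ∈ P*} sup_{1 ≤ r ≤ σ_p} (λ_r(-X) - λ_{r+1}(-X))`. -/
def gap : ℝ :=
  sInf ((fun X => sSup ((fun r : ℕ => lam (-X) r - lam (-X) (r + 1)) '' Set.Icc 1 D.sigmaP))
    '' D.primalOpt)

/-- The largest operator norm of a primal optimal solution. -/
def primalOpMax : ℝ := sSup (opNorm '' D.primalOpt)

/-- The explicit constant `4 ρ max {144 sup ‖X*‖_op / δ², 9 (8 √2 + 16) / δ}`. -/
def etaConst (ρ : ℝ) : ℝ :=
  4 * ρ * max (144 * D.primalOpMax / D.gap ^ 2) (9 * (8 * Real.sqrt 2 + 16) / D.gap)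

/-- The penalized cost `F(X) = ⟨C, X⟩ + ρ max {λ_max(-X), 0}`. -/
def F (ρ : ℝ) (X : Matrix (Fin n) (Fin n) ℝ) : ℝ :=
  innerF D.C X + ρ * max (lam (-X) 1) 0

/-- `{γ W̄ + P S Pᵀ | S ⪰ 0, γ ≥ 0, γ + tr S ≤ τ}`. -/
def weightSet {r : ℕ} (τ : ℝ) (Wbar : Matrix (Fin n) (Fin n) ℝ)
    (P : Matrix (Fin n) (Fin r) ℝ) : Set (Matrix (Fin n) (Fin n) ℝ) :=
  {W | ∃ (γ : ℝ) (S : Matrix (Fin r) (Fin r) ℝ),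
    S.PosSemidef ∧ 0 ≤ γ ∧ γ + S.trace ≤ τ ∧ W = γ • Wbar + P * S * Pᵀ}

/-- The spectral lower model
`⟨C, X⟩ + ρ max {⟨γ W̄ + P S Pᵀ, -X⟩ | S ⪰ 0, γ ≥ 0, γ + tr S ≤ 1}`. -/
def model {r : ℕ} (ρ : ℝ) (Wbar : Matrix (Fin n) (Fin n) ℝ) (P : Matrix (Fin n) (Fin r) ℝ)
    (X : Matrix (Fin n) (Fin n) ℝ) : ℝ :=
  innerF D.C X + ρ * sSup ((fun W => innerF W (-X)) '' weightSet 1 Wbar P)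

/-- Objective of the regularized master problem in `X`, with proximal center `Om`. -/
def masterObj {r : ℕ} (ρ α : ℝ) (Wbar : Matrix (Fin n) (Fin n) ℝ)
    (P : Matrix (Fin n) (Fin r) ℝ) (Om X : Matrix (Fin n) (Fin n) ℝ) : ℝ :=
  D.model ρ Wbar P X + α / 2 * normSqF (X - Om)

/-- Objective of the dual form of the master problem in `(W, y)`, to be minimized over
`W ∈ weightSet ρ W̄ P` and `y`. -/
def dualMasterObj (α : ℝ) (Om W : Matrix (Fin n) (Fin n) ℝ) (y : Fin m → ℝ) : ℝ :=
  innerF (W - D.C) Om - (fun i => D.b i - innerF (D.A i) Om) ⬝ᵥ y +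
    1 / (2 * α) * normSqF (W - D.C + D.adj y)

/-- An (infinite) execution of the spectral bundle method for the primal program, with penalty
`ρ`, proximal weight `α`, descent parameter `β`, `rp` past and `rc` current eigenvectors, and
starting point `Om0`. All choices the method leaves open (the initial weight, orthonormal bases
of eigenvectors, minimizers that are not unique) are arbitrary. -/
structure Run (ρ α β : ℝ) (rp rc : ℕ) (Om0 : Matrix (Fin n) (Fin n) ℝ) where
  /-- reference points (proximal centers) `Ω_t` -/
  Om : ℕ → Matrix (Fin n) (Fin n) ℝ
  /-- candidates `X_t*`: `cand (t + 1)` is computed at iteration `t`; `cand 0 = Ω_0` -/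
  cand : ℕ → Matrix (Fin n) (Fin n) ℝ
  /-- weight matrices `W̄_t` -/
  Wbar : ℕ → Matrix (Fin n) (Fin n) ℝ
  /-- orthonormal matrices `P_t` -/
  P : ℕ → Matrix (Fin n) (Fin (rp + rc)) ℝ
  /-- master solutions `γ_t*`, `S_t*`, `y_t*` -/
  γ : ℕ → ℝ
  S : ℕ → Matrix (Fin (rp + rc)) (Fin (rp + rc)) ℝ
  y : ℕ → Fin m → ℝ
  /-- `Q_t = [Q_1 Q_2]` of the eigenvalue decomposition of `S_t*` -/
  Q : ℕ → Matrix (Fin (rp + rc)) (Fin (rp + rc)) ℝ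
  /-- top `rc` eigenvectors `V_t` of `-X_{t+1}*` -/
  V : ℕ → Matrix (Fin n) (Fin rc) ℝ
  Om_zero : Om 0 = Om0
  cand_zero : cand 0 = Om0
  P_zero : IsTopEigenvectors (-Om0) (P 0)
  Wbar_zero : (Wbar 0).PosSemidef ∧ (Wbar 0).trace = 1
  /-- `X_{t+1}*` solves the master problem -/
  cand_opt : ∀ t, IsMinOn (D.masterObj ρ α (Wbar t) (P t) (Om t)) D.affineSet (cand (t + 1))
  cand_mem : ∀ t, cand (t + 1) ∈ D.affineSet
  /-- `(γ_t*, S_t*)` is feasible and, with `y_t*`, solves the dual form of the master problem -/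
  S_psd : ∀ t, (S t).PosSemidef
  γ_nonneg : ∀ t, 0 ≤ γ t
  coeff_le : ∀ t, γ t + (S t).trace ≤ ρ
  dual_opt : ∀ t, ∀ W ∈ weightSet ρ (Wbar t) (P t), ∀ y' : Fin m → ℝ,
    D.dualMasterObj α (Om t) (γ t • Wbar t + P t * S t * (P t)ᵀ) (y t) ≤
      D.dualMasterObj α (Om t) W y'
  /-- the first reference point is replaced if it violates the affine constraint -/
  step_affine : Om 0 ∉ D.affineSet → Om 1 = cand 1
  /-- descent step -/
  step_descent : ∀ t, (t ≠ 0 ∨ Om 0 ∈ D.affineSet) →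
    β * (D.F ρ (Om t) - D.model ρ (Wbar t) (P t) (cand (t + 1))) ≤
      D.F ρ (Om t) - D.F ρ (cand (t + 1)) → Om (t + 1) = cand (t + 1)
  /-- null step -/
  step_null : ∀ t, (t ≠ 0 ∨ Om 0 ∈ D.affineSet) →
    ¬ β * (D.F ρ (Om t) - D.model ρ (Wbar t) (P t) (cand (t + 1))) ≤
      D.F ρ (Om t) - D.F ρ (cand (t + 1)) → Om (t + 1) = Om t
  Q_eig : ∀ t, IsTopEigenvectors (S t) (Q t)
  V_eig : ∀ t, IsTopEigenvectors (-cand (t + 1)) (V t)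
  /-- `P_{t+1}` has orthonormal columns whose span contains those of `V_t` and `P_t Q_1` -/
  P_orth : ∀ t, (P (t + 1))ᵀ * P (t + 1) = 1
  P_span_current : ∀ t,
    LinearMap.range (V t).mulVecLin ≤ LinearMap.range (P (t + 1)).mulVecLin
  P_span_past : ∀ t,
    LinearMap.range (P t * (Q t).submatrix id (Fin.castAdd rc)).mulVecLin ≤
      LinearMap.range (P (t + 1)).mulVecLin
  /-- `W̄_{t+1} = (γ W̄_t + P_t Q_2 Σ_2 Q_2ᵀ P_tᵀ) / (γ + tr Σ_2)` -/
  Wbar_succ : ∀ t, γ t + (∑ j : Fin rc, lam (S t) (rp + (j : ℕ) + 1)) ≠ 0 →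
    Wbar (t + 1) = (γ t + ∑ j : Fin rc, lam (S t) (rp + (j : ℕ) + 1))⁻¹ •
      (γ t • Wbar t + P t * ((Q t).submatrix id (Fin.natAdd rp) *
        Matrix.diagonal (fun j : Fin rc => lam (S t) (rp + (j : ℕ) + 1)) *
        ((Q t).submatrix id (Fin.natAdd rp))ᵀ) * (P t)ᵀ)
  /-- if nothing is left to aggregate, the next weight is any admissible one -/
  Wbar_succ_zero : ∀ t, γ t + (∑ j : Fin rc, lam (S t) (rp + (j : ℕ) + 1)) = 0 →
    (Wbar (t + 1)).PosSemidef ∧ (Wbar (t + 1)).trace = 1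

end SDP

end SBMP

end

/-!
Since `ρ` exceeds every dual trace, `F` is an exact penalty: on the affine set its minimizers are
the primal optima and its sublevel sets are compact, so reference points of nearly optimal cost are
close to `P*`. To see that the cost does become nearly optimal, follow the optimal value `v_t` of
the master problem. The new model contains the aggregate weight and a top eigenvector of the
candidate, so a null step raises `v_t` by an amount depending only on the model error, while a
descent step lowers `F` by a fixed fraction of that error; a weighted combination of the two
decreases at a uniform rate as long as the cost is not nearly optimal.

On `P*` the eigenvalue of `-X` of index `σ_p + 1` lies a uniform distance `g` below
`max (λ_1) 0`, and by Weyl's inequality `2 g / 3` of this separation survives near `P*`. If the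
model contains the top `r_c ≥ σ_p` eigenvectors of `-Ω_t`, then splitting a vector along them and
their orthogonal complement bounds the model error at `X` by a multiple of `‖X - Ω_t‖² / g`. The
model always contains these eigenvectors right after a descent step. For `η ≤ α` and `β ≤ 1/2` the
quadratic bound is itself the descent test, so once it holds near `P*` every later step is a descent
step and the eigenvectors are never lost.
-/

namespace SBMP

open scoped Matrix.Norms.Frobenius InnerProductSpace

/-! ### Eigenvalues of symmetric matrices -/

section TraceInnerProduct

variable {p q : ℕ}

theorem innerF_eq_sum (M N : Matrix (Fin p) (Fin q) ℝ) :
    innerF M N = ∑ i, ∑ j, M i j * N i j := by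
  rw [Finset.sum_comm]
  simp [innerF, Matrix.trace, Matrix.mul_apply]

theorem norm_sq_eq_innerF_self (M : Matrix (Fin p) (Fin q) ℝ) : ‖M‖ ^ 2 = innerF M M := by
  rw [frobenius_norm_def, ← Real.sqrt_eq_rpow, Real.sq_sqrt (by positivity), innerF_eq_sum]
  simp only [Real.rpow_two, Real.norm_eq_abs, sq_abs, ← pow_two]

/-- The trace inner product on real matrices, which induces the Frobenius norm. -/
noncomputable scoped instance : InnerProductSpace ℝ (Matrix (Fin p) (Fin q) ℝ) where
  inner := innerF
  norm_sq_eq_re_inner := norm_sq_eq_innerF_self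
  conj_inner_symm M N := by simp [innerF_eq_sum, mul_comm]
  add_left M N K := by simp [innerF, Matrix.add_mul]
  smul_left M N c := by simp [innerF]

theorem innerF_eq_inner (M N : Matrix (Fin p) (Fin q) ℝ) : innerF M N = ⟪M, N⟫_ℝ := rfl

theorem normSqF_eq_norm_sq (M : Matrix (Fin p) (Fin q) ℝ) : normSqF M = ‖M‖ ^ 2 :=
  (norm_sq_eq_innerF_self M).symm

theorem inner_one_right (M : Matrix (Fin p) (Fin p) ℝ) : ⟪M, 1⟫_ℝ = M.trace := by
  simp [← innerF_eq_inner, innerF]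

theorem inner_vecMulVec_left (u : Fin p → ℝ) (v : Fin q → ℝ) (M : Matrix (Fin p) (Fin q) ℝ) :
    ⟪vecMulVec u v, M⟫_ℝ = u ⬝ᵥ M *ᵥ v := by
  simp only [← innerF_eq_inner, innerF_eq_sum, vecMulVec_apply, dotProduct, mulVec, Finset.mul_sum]
  exact Finset.sum_congr rfl fun i _ => Finset.sum_congr rfl fun j _ => by ring

theorem dotProduct_self_nonneg (u : Fin p → ℝ) : 0 ≤ u ⬝ᵥ u := by
  simpa using dotProduct_star_self_nonneg u

theorem dotProduct_self_pos {u : Fin p → ℝ} (hu : u ≠ 0) : 0 < u ⬝ᵥ u :=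
  (dotProduct_self_nonneg u).lt_of_ne fun h => hu (dotProduct_self_eq_zero.1 h.symm)

theorem mulVec_dotProduct_mulVec {V : Matrix (Fin p) (Fin q) ℝ} (hV : Vᵀ * V = 1)
    (a b : Fin q → ℝ) : (V *ᵥ a) ⬝ᵥ (V *ᵥ b) = a ⬝ᵥ b := by
  rw [dotProduct_mulVec, ← mulVec_transpose, mulVec_mulVec, hV, one_mulVec]

theorem norm_vecMulVec_sq (u : Fin p → ℝ) (v : Fin q → ℝ) :
    ‖vecMulVec u v‖ ^ 2 = (u ⬝ᵥ u) * (v ⬝ᵥ v) := by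
  rw [← real_inner_self_eq_norm_sq, inner_vecMulVec_left, vecMulVec_mulVec]
  simp [dotProduct_smul, mul_comm]

theorem abs_dotProduct_mulVec_self_le (u : Fin p → ℝ) (M : Matrix (Fin p) (Fin p) ℝ) :
    |u ⬝ᵥ M *ᵥ u| ≤ ‖M‖ * (u ⬝ᵥ u) := by
  have hnorm : ‖vecMulVec u u‖ = u ⬝ᵥ u := by
    rw [← sq_eq_sq₀ (norm_nonneg _) (dotProduct_self_nonneg u), norm_vecMulVec_sq, pow_two]
  rw [← inner_vecMulVec_left, mul_comm, ← hnorm]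
  exact abs_real_inner_le_norm _ _

theorem two_mul_dotProduct_mulVec_le {s : ℝ} (hs : 0 < s) (u : Fin p → ℝ) (v : Fin q → ℝ)
    (M : Matrix (Fin p) (Fin q) ℝ) :
    2 * (u ⬝ᵥ M *ᵥ v) ≤ s * (u ⬝ᵥ u) + ‖M‖ ^ 2 / s * (v ⬝ᵥ v) := by
  rw [← inner_vecMulVec_left]
  have hCS := real_inner_le_norm (vecMulVec u v) M
  have hrhs : 0 ≤ s * (u ⬝ᵥ u) + ‖M‖ ^ 2 / s * (v ⬝ᵥ v) := by
    have := dotProduct_self_nonneg u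
    have := dotProduct_self_nonneg v
    positivity
  refine (mul_le_mul_of_nonneg_left hCS zero_le_two).trans (abs_le_of_sq_le_sq' ?_ hrhs).2
  have hprod : s * (u ⬝ᵥ u) * (‖M‖ ^ 2 / s * (v ⬝ᵥ v)) = (‖vecMulVec u v‖ * ‖M‖) ^ 2 := by
    rw [mul_pow, norm_vecMulVec_sq]; field_simp
  linarith [sq_nonneg (s * (u ⬝ᵥ u) - ‖M‖ ^ 2 / s * (v ⬝ᵥ v))]

theorem opNorm_le_norm (M : Matrix (Fin p) (Fin p) ℝ) : opNorm M ≤ ‖M‖ := by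
  refine ContinuousLinearMap.opNorm_le_bound _ (norm_nonneg M) fun x => ?_
  have h := frobenius_norm_mul M (replicateCol Unit x.ofLp)
  rwa [← replicateCol_mulVec, frobenius_norm_replicateCol, frobenius_norm_replicateCol] at h

end TraceInnerProduct

section Spectral

variable {p k : ℕ} {M N : Matrix (Fin p) (Fin p) ℝ}

theorem posSemidef_iff : M.PosSemidef ↔ M.IsSymm ∧ ∀ x : Fin p → ℝ, 0 ≤ x ⬝ᵥ M *ᵥ x := by
  rw [posSemidef_iff_dotProduct_mulVec, isHermitian_iff_isSymm]; simp

theorem isSymm_of_posSemidef (hM : M.PosSemidef) : M.IsSymm := (posSemidef_iff.1 hM).1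

theorem isClosed_setOf_isSymm : IsClosed {M : Matrix (Fin p) (Fin p) ℝ | M.IsSymm} :=
  isClosed_eq (by fun_prop) continuous_id

theorem isClosed_setOf_posSemidef : IsClosed {M : Matrix (Fin p) (Fin p) ℝ | M.PosSemidef} := by
  simp only [posSemidef_iff, Set.ofPred_and, Set.ofPred_forall]
  exact isClosed_setOf_isSymm.inter <| isClosed_iInter fun x =>
    isClosed_le continuous_const (by fun_prop)

theorem dotProduct_mulVec_comm (hM : M.IsSymm) (x y : Fin p → ℝ) :
    x ⬝ᵥ M *ᵥ y = y ⬝ᵥ M *ᵥ x := by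
  rw [dotProduct_mulVec, ← mulVec_transpose, hM, dotProduct_comm]

theorem lam_eq_zero_of_not_mem_Icc (hk : k ∉ Set.Icc 1 p) : lam M k = 0 :=
  dif_neg fun h => hk h.2

theorem lam_antitone (hM : M.IsSymm) {i j : ℕ} (hij : i ≤ j) (hj : j < p) :
    lam M (j + 1) ≤ lam M (i + 1) := by
  have h := isHermitian_iff_isSymm.2 hM
  rw [lam, lam, dif_pos ⟨h, by omega, by omega⟩, dif_pos ⟨h, by omega, by omega⟩]
  exact h.eigenvalues₀_antitone (by simpa using hij)

theorem exists_isTopEigenvectors (hM : M.IsSymm) :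
    ∃ U : Matrix (Fin p) (Fin p) ℝ, IsTopEigenvectors M U := by
  have h := isHermitian_iff_isSymm.2 hM
  let e : Fin p ≃ Fin p :=
    (finCongr (Fintype.card_fin p).symm).trans (Fintype.equivOfCardEq (Fintype.card_fin _))
  have he : ∀ j, h.eigenvalues (e j) = lam M ((j : ℕ) + 1) := fun j => by
    rw [lam, dif_pos ⟨h, by omega, by omega⟩, Matrix.IsHermitian.eigenvalues]
    congr 1
    simp only [e, Equiv.trans_apply, Equiv.symm_apply_apply]
    ext
    simp
  refine ⟨Matrix.of fun i j => h.eigenvectorBasis (e j) i, ?_, ?_⟩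
  · ext i j
    have := orthonormal_iff_ite.1 h.eigenvectorBasis.orthonormal (e i) (e j)
    simpa [PiLp.inner_apply, Matrix.mul_apply, Matrix.one_apply, mul_comm] using this
  · ext i j
    have := congrFun (h.mulVec_eigenvectorBasis (e j)) i
    rw [he] at this
    simp only [mul_diagonal, of_apply]
    rw [mul_comm]
    simpa [Matrix.mul_apply, mulVec, dotProduct] using this

namespace IsTopEigenvectors

variable {V : Matrix (Fin p) (Fin k) ℝ} {U : Matrix (Fin p) (Fin p) ℝ}

theorem castLE {k' : ℕ} (h : k' ≤ k) (hV : IsTopEigenvectors M V) :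
    IsTopEigenvectors M (V.submatrix id (Fin.castLE h)) := by
  refine ⟨?_, ?_⟩
  · ext i j
    have := congrFun (congrFun hV.1 (Fin.castLE h i)) (Fin.castLE h j)
    simpa [Matrix.mul_apply, Matrix.one_apply] using this
  · ext i j
    have := congrFun (congrFun hV.2 i) (Fin.castLE h j)
    rw [mul_diagonal] at this ⊢
    simpa [Matrix.mul_apply] using this

theorem mulVec_mulVec (hV : IsTopEigenvectors M V) (a : Fin k → ℝ) :
    M *ᵥ (V *ᵥ a) = V *ᵥ fun j => lam M ((j : ℕ) + 1) * a j := by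
  rw [Matrix.mulVec_mulVec, hV.2, ← Matrix.mulVec_mulVec]
  congr 1; ext j; simp [mulVec_diagonal]

theorem rayleigh_mulVec (hV : IsTopEigenvectors M V) (a : Fin k → ℝ) :
    (V *ᵥ a) ⬝ᵥ M *ᵥ (V *ᵥ a) = ∑ j : Fin k, lam M ((j : ℕ) + 1) * a j ^ 2 := by
  rw [hV.mulVec_mulVec, mulVec_dotProduct_mulVec hV.1]
  exact Finset.sum_congr rfl fun j _ => by ring

theorem dotProduct_col_self (hV : IsTopEigenvectors M V) (j : Fin k) :
    V.col j ⬝ᵥ V.col j = 1 := by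
  rw [← mulVec_single_one, mulVec_dotProduct_mulVec hV.1]; simp

theorem rayleigh_col (hV : IsTopEigenvectors M V) (j : Fin k) :
    V.col j ⬝ᵥ M *ᵥ V.col j = lam M ((j : ℕ) + 1) := by
  rw [← mulVec_single_one, hV.rayleigh_mulVec]
  simp [Pi.single_apply]

theorem mul_transpose (hU : IsTopEigenvectors M U) : U * Uᵀ = 1 :=
  mul_eq_one_comm.1 hU.1

theorem eq_mul_diagonal_mul_transpose (hU : IsTopEigenvectors M U) :
    M = U * diagonal (fun j : Fin p => lam M ((j : ℕ) + 1)) * Uᵀ := by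
  rw [← hU.2, Matrix.mul_assoc, hU.mul_transpose, Matrix.mul_one]

theorem mulVec_transpose_mulVec (hU : IsTopEigenvectors M U) (x : Fin p → ℝ) :
    U *ᵥ (Uᵀ *ᵥ x) = x := by
  rw [Matrix.mulVec_mulVec, hU.mul_transpose, one_mulVec]

theorem inner_eq_sum_lam (hU : IsTopEigenvectors M U) (N : Matrix (Fin p) (Fin p) ℝ) :
    ⟪M, N⟫_ℝ = ∑ j : Fin p, lam M ((j : ℕ) + 1) * (U.col j ⬝ᵥ N *ᵥ U.col j) := by
  have hMU : M = ∑ j : Fin p, lam M ((j : ℕ) + 1) • vecMulVec (U.col j) (U.col j) := by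
    conv_lhs => rw [hU.eq_mul_diagonal_mul_transpose]
    ext a b
    rw [Matrix.mul_apply, Matrix.sum_apply]
    refine Finset.sum_congr rfl fun j _ => ?_
    simp only [mul_diagonal, transpose_apply, Matrix.smul_apply, vecMulVec_apply,
      col_apply, smul_eq_mul]
    ring
  conv_lhs => rw [hMU]
  simp only [sum_inner, real_inner_smul_left, inner_vecMulVec_left]

end IsTopEigenvectors

theorem lam_nonneg_of_posSemidef (hM : M.PosSemidef) (k : ℕ) : 0 ≤ lam M k := by
  by_cases hk : k ∈ Set.Icc 1 p
  · obtain ⟨U, hU⟩ := exists_isTopEigenvectors (isSymm_of_posSemidef hM)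
    obtain ⟨j, rfl⟩ : ∃ j, k = j + 1 := ⟨k - 1, by grind⟩
    rw [← hU.rayleigh_col ⟨j, hk.2⟩]
    exact (posSemidef_iff.1 hM).2 _
  · exact (lam_eq_zero_of_not_mem_Icc hk).ge

theorem lam_neg_one_nonpos_of_posSemidef (hM : M.PosSemidef) : lam (-M) 1 ≤ 0 := by
  by_cases hp : 1 ∈ Set.Icc 1 p
  · obtain ⟨U, hU⟩ := exists_isTopEigenvectors (isSymm_of_posSemidef hM).neg
    have h := hU.rayleigh_col ⟨0, hp.2⟩
    rw [neg_mulVec, dotProduct_neg, zero_add] at h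
    linarith [(posSemidef_iff.1 hM).2 (U.col ⟨0, hp.2⟩)]
  · exact (lam_eq_zero_of_not_mem_Icc hp).le

theorem lam_neg_one_neg_of_posDef (hp : 0 < p) (hM : M.PosDef) : lam (-M) 1 < 0 := by
  obtain ⟨U, hU⟩ := exists_isTopEigenvectors (isSymm_of_posSemidef hM.posSemidef).neg
  have hU0 : U.col ⟨0, hp⟩ ≠ 0 := fun h => by simpa [h] using hU.dotProduct_col_self ⟨0, hp⟩
  have h := hU.rayleigh_col ⟨0, hp⟩
  rw [neg_mulVec, dotProduct_neg, zero_add] at h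
  have hpos := hM.dotProduct_mulVec_pos hU0
  rw [star_trivial] at hpos
  linarith

theorem rayleigh_le_lam_of_forall_lt {U : Matrix (Fin p) (Fin p) ℝ} (hM : M.IsSymm)
    (hU : IsTopEigenvectors M U) {x : Fin p → ℝ}
    (hx : ∀ i : Fin p, (i : ℕ) < k → (Uᵀ *ᵥ x) i = 0) :
    x ⬝ᵥ M *ᵥ x ≤ lam M (k + 1) * (x ⬝ᵥ x) := by
  rw [← hU.mulVec_transpose_mulVec x, hU.rayleigh_mulVec, mulVec_dotProduct_mulVec hU.1, dotProduct,
    Finset.mul_sum]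
  refine Finset.sum_le_sum fun i _ => ?_
  by_cases hi : (i : ℕ) < k
  · simp [hx i hi]
  · rw [← pow_two]
    exact mul_le_mul_of_nonneg_right (lam_antitone hM (not_lt.1 hi) i.2) (sq_nonneg _)

theorem rayleigh_le_lam_one (hM : M.IsSymm) (x : Fin p → ℝ) :
    x ⬝ᵥ M *ᵥ x ≤ lam M 1 * (x ⬝ᵥ x) := by
  obtain ⟨U, hU⟩ := exists_isTopEigenvectors hM
  exact rayleigh_le_lam_of_forall_lt (k := 0) hM hU (by simp)

theorem neg_lam_neg_one_mul_le_rayleigh (hM : M.IsSymm) (x : Fin p → ℝ) :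
    -lam (-M) 1 * (x ⬝ᵥ x) ≤ x ⬝ᵥ M *ᵥ x := by
  have h := rayleigh_le_lam_one hM.neg x
  rw [neg_mulVec, dotProduct_neg] at h
  linarith

theorem posSemidef_of_lam_neg_one_nonpos (hM : M.IsSymm) (h : lam (-M) 1 ≤ 0) :
    M.PosSemidef :=
  posSemidef_iff.2 ⟨hM, fun x => (mul_nonneg (neg_nonneg.2 h) (dotProduct_self_nonneg x)).trans
    (neg_lam_neg_one_mul_le_rayleigh hM x)⟩

theorem posSemidef_add_lam_smul_one (hM : M.IsSymm) :
    (M + max (lam (-M) 1) 0 • (1 : Matrix (Fin p) (Fin p) ℝ)).PosSemidef := by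
  refine posSemidef_iff.2 ⟨hM.add (isSymm_one.smul _), fun x => ?_⟩
  rw [add_mulVec, dotProduct_add, smul_mulVec, one_mulVec, dotProduct_smul, smul_eq_mul]
  nlinarith [neg_lam_neg_one_mul_le_rayleigh hM x, dotProduct_self_nonneg x,
    le_max_left (lam (-M) 1) 0]

theorem exists_pos_mul_le_rayleigh (hM : M.PosDef) :
    ∃ c : ℝ, 0 < c ∧ ∀ x : Fin p → ℝ, c * (x ⬝ᵥ x) ≤ x ⬝ᵥ M *ᵥ x := by
  rcases Nat.eq_zero_or_pos p with rfl | hp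
  · exact ⟨1, one_pos, fun x => by simp [dotProduct]⟩
  · exact ⟨-lam (-M) 1, neg_pos.2 (lam_neg_one_neg_of_posDef hp hM),
      neg_lam_neg_one_mul_le_rayleigh (isSymm_of_posSemidef hM.posSemidef)⟩

theorem lt_lam_of_forall_lt_rayleigh (hM : M.IsSymm) (hk : k < p) {c : ℝ}
    (T : (Fin (k + 1) → ℝ) →ₗ[ℝ] (Fin p → ℝ))
    (hT : ∀ a, a ≠ 0 → c * (T a ⬝ᵥ T a) < T a ⬝ᵥ M *ᵥ T a) : c < lam M (k + 1) := by
  by_contra! hc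
  obtain ⟨U, hU⟩ := exists_isTopEigenvectors hM
  let L : (Fin (k + 1) → ℝ) →ₗ[ℝ] (Fin k → ℝ) :=
    LinearMap.funLeft ℝ ℝ (Fin.castLE hk.le) ∘ₗ Uᵀ.mulVecLin ∘ₗ T
  obtain ⟨a, ha, ha0⟩ : ∃ a ∈ LinearMap.ker L, a ≠ 0 :=
    Submodule.exists_mem_ne_zero_of_ne_bot (LinearMap.ker_ne_bot_of_finrank_lt (by simp))
  have h1 := rayleigh_le_lam_of_forall_lt hM hU (x := T a) fun i hi =>
    congrFun (LinearMap.mem_ker.1 ha) ⟨i, hi⟩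
  linarith [hT a ha0, mul_le_mul_of_nonneg_right hc (dotProduct_self_nonneg (T a))]

theorem lam_succ_le_add_norm (hM : M.IsSymm) (hN : N.IsSymm) (hk : k < p) :
    lam M (k + 1) ≤ lam N (k + 1) + ‖M - N‖ := by
  rw [← sub_le_iff_le_add]
  refine le_of_forall_lt fun c hc => ?_
  obtain ⟨U, hU⟩ := exists_isTopEigenvectors hM
  have hV := hU.castLE (k' := k + 1) hk
  set V := U.submatrix id (Fin.castLE (n := k + 1) hk)
  refine lt_lam_of_forall_lt_rayleigh hN hk V.mulVecLin fun a ha => ?_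
  have h1 : lam M (k + 1) * (a ⬝ᵥ a) ≤ (V *ᵥ a) ⬝ᵥ M *ᵥ (V *ᵥ a) := by
    rw [hV.rayleigh_mulVec, dotProduct, Finset.mul_sum]
    refine Finset.sum_le_sum fun i _ => ?_
    rw [← pow_two]
    exact mul_le_mul_of_nonneg_right (lam_antitone hM (Nat.lt_succ_iff.1 i.2) hk) (sq_nonneg _)
  have h2 := (abs_le.1 (abs_dotProduct_mulVec_self_le (V *ᵥ a) (M - N))).2
  rw [sub_mulVec, dotProduct_sub, mulVec_dotProduct_mulVec hV.1] at h2
  rw [mulVecLin_apply, mulVec_dotProduct_mulVec hV.1]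
  linarith [mul_lt_mul_of_pos_right hc (dotProduct_self_pos ha)]

theorem abs_lam_sub_le (hM : M.IsSymm) (hN : N.IsSymm) (k : ℕ) :
    |lam M k - lam N k| ≤ ‖M - N‖ := by
  by_cases hk : k ∈ Set.Icc 1 p
  · obtain ⟨j, rfl⟩ : ∃ j, k = j + 1 := ⟨k - 1, by grind⟩
    have h1 := lam_succ_le_add_norm hM hN hk.2
    have h2 := lam_succ_le_add_norm hN hM hk.2
    rw [norm_sub_rev] at h2
    exact abs_sub_le_iff.2 ⟨by linarith, by linarith⟩
  · simp [lam_eq_zero_of_not_mem_Icc hk]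

namespace IsTopEigenvectors

variable {V : Matrix (Fin p) (Fin k) ℝ} {w : Fin p → ℝ}

theorem mulVec_dotProduct_of_orthogonal {V : Matrix (Fin p) (Fin k) ℝ} (hw : Vᵀ *ᵥ w = 0)
    (a : Fin k → ℝ) : (V *ᵥ a) ⬝ᵥ w = 0 := by
  rw [dotProduct_comm, Matrix.dotProduct_mulVec, ← mulVec_transpose, hw, zero_dotProduct]

theorem dotProduct_self_add_of_orthogonal (hV : IsTopEigenvectors M V) (hw : Vᵀ *ᵥ w = 0)
    (a : Fin k → ℝ) : (V *ᵥ a + w) ⬝ᵥ (V *ᵥ a + w) = a ⬝ᵥ a + w ⬝ᵥ w := by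
  have h := mulVec_dotProduct_of_orthogonal hw a
  simp only [add_dotProduct, dotProduct_add, mulVec_dotProduct_mulVec hV.1, dotProduct_comm w, h]
  ring

theorem rayleigh_add_of_orthogonal (hV : IsTopEigenvectors M V) (hM : M.IsSymm)
    (hw : Vᵀ *ᵥ w = 0) (a : Fin k → ℝ) :
    (V *ᵥ a + w) ⬝ᵥ M *ᵥ (V *ᵥ a + w) =
      ∑ i : Fin k, lam M ((i : ℕ) + 1) * a i ^ 2 + w ⬝ᵥ M *ᵥ w := by
  have h : w ⬝ᵥ M *ᵥ (V *ᵥ a) = 0 := by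
    rw [hV.mulVec_mulVec, dotProduct_comm, mulVec_dotProduct_of_orthogonal hw]
  simp only [mulVec_add, add_dotProduct, dotProduct_add, dotProduct_mulVec_comm hM (V *ᵥ a) w, h,
    hV.rayleigh_mulVec]
  ring

theorem lt_lam_of_orthogonal (hV : IsTopEigenvectors M V) (hM : M.IsSymm) (hk : k < p) {c : ℝ}
    (hc : ∀ i < k, c < lam M (i + 1)) (hw : Vᵀ *ᵥ w = 0)
    (hcw : c * (w ⬝ᵥ w) < w ⬝ᵥ M *ᵥ w) : c < lam M (k + 1) := by
  let T : (Fin (k + 1) → ℝ) →ₗ[ℝ] (Fin p → ℝ) :=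
    V.mulVecLin ∘ₗ LinearMap.funLeft ℝ ℝ Fin.castSucc +
      (LinearMap.proj (Fin.last k)).smulRight w
  refine lt_lam_of_forall_lt_rayleigh hM hk T fun a ha => ?_
  set s := a (Fin.last k)
  have hsw : Vᵀ *ᵥ (s • w) = 0 := by rw [mulVec_smul, hw, smul_zero]
  change c * ((V *ᵥ (a ∘ Fin.castSucc) + s • w) ⬝ᵥ (V *ᵥ (a ∘ Fin.castSucc) + s • w)) <
    (V *ᵥ (a ∘ Fin.castSucc) + s • w) ⬝ᵥ M *ᵥ (V *ᵥ (a ∘ Fin.castSucc) + s • w)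
  rw [hV.dotProduct_self_add_of_orthogonal hsw, hV.rayleigh_add_of_orthogonal hM hsw]
  have hi_pos : ∀ i : Fin k, 0 < lam M ((i : ℕ) + 1) - c := fun i => sub_pos.2 (hc i i.2)
  have hterm : ∀ i ∈ Finset.univ, 0 ≤ (lam M ((i : Fin k) + 1 : ℕ) - c) * a i.castSucc ^ 2 :=
    fun i _ => mul_nonneg (hi_pos i).le (sq_nonneg _)
  have hpos : 0 < ∑ i : Fin k, (lam M ((i : ℕ) + 1) - c) * a i.castSucc ^ 2 +
      s ^ 2 * (w ⬝ᵥ M *ᵥ w - c * (w ⬝ᵥ w)) := by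
    obtain ⟨i, hi⟩ := Function.ne_iff.1 ha
    induction i using Fin.lastCases with
    | last =>
      exact add_pos_of_nonneg_of_pos (Finset.sum_nonneg hterm)
        (mul_pos (sq_pos_of_ne_zero hi) (sub_pos.2 hcw))
    | cast i =>
      exact add_pos_of_pos_of_nonneg
        (Finset.sum_pos' hterm ⟨i, Finset.mem_univ i, mul_pos (hi_pos i) (sq_pos_of_ne_zero hi)⟩)
        (mul_nonneg (sq_nonneg s) (sub_pos.2 hcw).le)
  have hsq : (a ∘ Fin.castSucc) ⬝ᵥ (a ∘ Fin.castSucc) = ∑ i : Fin k, a i.castSucc ^ 2 := by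
    simp only [dotProduct, Function.comp_apply, pow_two]
  simp only [sub_mul, Finset.sum_sub_distrib, ← Finset.mul_sum] at hpos
  simp only [hsq, mulVec_smul, dotProduct_smul, smul_dotProduct, smul_eq_mul, Function.comp_apply]
  linarith

theorem rayleigh_le_of_orthogonal (hV : IsTopEigenvectors M V) (hM : M.IsSymm) (hk : k < p)
    (hw : Vᵀ *ᵥ w = 0) : w ⬝ᵥ M *ᵥ w ≤ lam M (k + 1) * (w ⬝ᵥ w) := by
  classical
  by_contra! hlt
  -- Discard the columns belonging to the eigenvalues equal to `lam M (k + 1)`.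
  have hex : ∃ j, lam M (j + 1) ≤ lam M (k + 1) := ⟨k, le_rfl⟩
  have hjk : Nat.find hex ≤ k := Nat.find_min' hex le_rfl
  refine absurd ((hV.castLE hjk).lt_lam_of_orthogonal hM (hjk.trans_lt hk)
    (fun i hi => not_le.1 (Nat.find_min hex hi)) ?_ hlt) (not_lt.2 (Nat.find_spec hex))
  ext i
  exact congrFun hw (Fin.castLE hjk i)

end IsTopEigenvectors

theorem lam_one_le_of_rayleigh_le (hM : M.IsSymm) (hp : 0 < p) {c : ℝ}
    (h : ∀ x : Fin p → ℝ, x ⬝ᵥ M *ᵥ x ≤ c * (x ⬝ᵥ x)) : lam M 1 ≤ c := by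
  obtain ⟨U, hU⟩ := exists_isTopEigenvectors hM
  simpa [hU.rayleigh_col, hU.dotProduct_col_self] using h (U.col ⟨0, hp⟩)

theorem inner_le_mul_trace_of_rayleigh_le {W : Matrix (Fin p) (Fin p) ℝ} (hW : W.PosSemidef)
    {c : ℝ} (hN : ∀ x : Fin p → ℝ, x ⬝ᵥ N *ᵥ x ≤ c * (x ⬝ᵥ x)) : ⟪W, N⟫_ℝ ≤ c * W.trace := by
  obtain ⟨U, hU⟩ := exists_isTopEigenvectors (isSymm_of_posSemidef hW)
  rw [← inner_one_right, hU.inner_eq_sum_lam, hU.inner_eq_sum_lam, Finset.mul_sum]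
  refine Finset.sum_le_sum fun j _ => ?_
  rw [one_mulVec, mul_left_comm]
  exact mul_le_mul_of_nonneg_left (hN _) (lam_nonneg_of_posSemidef hW _)

theorem inner_le_lam_one_mul_trace {W : Matrix (Fin p) (Fin p) ℝ} (hW : W.PosSemidef)
    (hN : N.IsSymm) : ⟪W, N⟫_ℝ ≤ lam N 1 * W.trace :=
  inner_le_mul_trace_of_rayleigh_le hW (rayleigh_le_lam_one hN)

theorem mul_trace_le_inner_of_le_rayleigh {W : Matrix (Fin p) (Fin p) ℝ} (hW : W.PosSemidef)
    {c : ℝ} (hN : ∀ x : Fin p → ℝ, c * (x ⬝ᵥ x) ≤ x ⬝ᵥ N *ᵥ x) : c * W.trace ≤ ⟪W, N⟫_ℝ := by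
  have h := inner_le_mul_trace_of_rayleigh_le hW (N := -N) (c := -c) fun x => by
    rw [neg_mulVec, dotProduct_neg]; linarith [hN x]
  rw [inner_neg_right] at h
  linarith

theorem inner_nonneg_of_posSemidef (hM : M.PosSemidef) (hN : N.PosSemidef) : 0 ≤ ⟪M, N⟫_ℝ := by
  simpa using mul_trace_le_inner_of_le_rayleigh hM (c := 0) fun x => by
    simpa using (posSemidef_iff.1 hN).2 x

theorem norm_le_trace_of_posSemidef (hM : M.PosSemidef) : ‖M‖ ≤ M.trace := by
  refine (sq_le_sq₀ (norm_nonneg M) hM.trace_nonneg).1 ?_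
  obtain ⟨U, hU⟩ := exists_isTopEigenvectors (isSymm_of_posSemidef hM)
  rw [← real_inner_self_eq_norm_sq, ← inner_one_right, hU.inner_eq_sum_lam, hU.inner_eq_sum_lam]
  simp only [hU.rayleigh_col, one_mulVec, hU.dotProduct_col_self, mul_one, ← pow_two]
  exact Finset.sum_sq_le_sq_sum_of_nonneg fun i _ => lam_nonneg_of_posSemidef hM _

end Spectral

/-! ### Strong duality and the exact penalty -/

theorem exists_sub_mem_orthogonal_forall_norm_sq_le_inner {E : Type*} [NormedAddCommGroup E]
    [InnerProductSpace ℝ E] {B : Set E} (hB : IsCompact B) (hBconv : Convex ℝ B)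
    (hBne : B.Nonempty) (S : Submodule ℝ E) [S.HasOrthogonalProjection]
    (hdisj : Disjoint B S) :
    ∃ z₀ ∈ B, ∃ w ∈ S, z₀ ≠ w ∧ z₀ - w ∈ Sᗮ ∧ ∀ z ∈ B, ‖z₀ - w‖ ^ 2 ≤ ⟪z, z₀ - w⟫_ℝ := by
  have hconv : Convex ℝ (Sᗮ.starProjection '' B) :=
    hBconv.linear_image Sᗮ.starProjection.toLinearMap
  obtain ⟨_, ⟨z₀, hz₀, rfl⟩, hmin⟩ := exists_norm_eq_iInf_of_complete_convex
    (hBne.image Sᗮ.starProjection) (hB.image Sᗮ.starProjection.continuous).isComplete hconv 0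
  have hle := (norm_eq_iInf_iff_real_inner_le_zero hconv ⟨z₀, hz₀, rfl⟩).1 hmin
  have hproj : Sᗮ.starProjection z₀ = z₀ - S.starProjection z₀ := by
    simp [Submodule.starProjection_orthogonal]
  refine ⟨z₀, hz₀, S.starProjection z₀, S.starProjection_apply_mem z₀, ?_, ?_, fun z hz => ?_⟩
  · exact fun h => Set.disjoint_left.1 hdisj hz₀ (h ▸ S.starProjection_apply_mem z₀)
  · exact hproj ▸ Sᗮ.starProjection_apply_mem z₀
  · have h := hle _ ⟨z, hz, rfl⟩
    rw [zero_sub, inner_neg_left, inner_sub_right, real_inner_self_eq_norm_sq, real_inner_comm,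
      Submodule.inner_starProjection_left_eq_right,
      Submodule.starProjection_eq_self_iff.2 (Sᗮ.starProjection_apply_mem z₀), hproj] at h
    linarith

section Cone

variable {p : ℕ} {M Y : Matrix (Fin p) (Fin p) ℝ}

theorem isCompact_setOf_posSemidef_inner_le (hM : M.PosDef) (κ : ℝ) :
    IsCompact {X : Matrix (Fin p) (Fin p) ℝ | X.PosSemidef ∧ ⟪M, X⟫_ℝ ≤ κ} := by
  obtain ⟨c, hc, hcM⟩ := exists_pos_mul_le_rayleigh hM
  refine Metric.isCompact_of_isClosed_isBounded ?_ ?_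
  · have hle : IsClosed {X : Matrix (Fin p) (Fin p) ℝ | ⟪M, X⟫_ℝ ≤ κ} :=
      isClosed_le (continuous_const.inner continuous_id) continuous_const
    exact isClosed_setOf_posSemidef.inter hle
  · refine isBounded_iff_forall_norm_le.2 ⟨κ / c, fun X ⟨hX, hle⟩ => ?_⟩
    have h := mul_trace_le_inner_of_le_rayleigh hX hcM
    rw [real_inner_comm] at h
    exact (norm_le_trace_of_posSemidef hX).trans ((le_div_iff₀' hc).2 (h.trans hle))

theorem convex_setOf_posSemidef_inner_le (κ : ℝ) :
    Convex ℝ {X : Matrix (Fin p) (Fin p) ℝ | X.PosSemidef ∧ ⟪M, X⟫_ℝ ≤ κ} := by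
  rintro X ⟨hX, hXκ⟩ Y ⟨hY, hYκ⟩ a b ha hb hab
  refine ⟨(hX.smul ha).add (hY.smul hb), ?_⟩
  rw [inner_add_right, real_inner_smul_right, real_inner_smul_right, ← one_mul κ, ← hab, add_mul]
  gcongr

theorem exists_pos_posSemidef_add_smul (hM : M.PosDef) (hY : Y.IsSymm) :
    ∃ s : ℝ, 0 < s ∧ (M + s • Y).PosSemidef := by
  obtain ⟨c, hc, hcM⟩ := exists_pos_mul_le_rayleigh hM
  have hY1 : 0 < ‖Y‖ + 1 := by positivity
  refine ⟨c / (‖Y‖ + 1), div_pos hc hY1,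
    posSemidef_iff.2 ⟨(isSymm_of_posSemidef hM.posSemidef).add (hY.smul _), fun x => ?_⟩⟩
  have h := (abs_le.1 (abs_dotProduct_mulVec_self_le x Y)).1
  have hs : c / (‖Y‖ + 1) * ‖Y‖ ≤ c := by
    rw [div_mul_eq_mul_div, div_le_iff₀ hY1]; linarith
  rw [add_mulVec, dotProduct_add, smul_mulVec, dotProduct_smul, smul_eq_mul]
  nlinarith [hcM x, mul_le_mul_of_nonneg_left h (div_pos hc hY1).le,
    mul_le_mul_of_nonneg_right hs (dotProduct_self_nonneg x)]

theorem posSemidef_add_smul_of_forall_neg_le_inner (hM : M.PosDef) (hY : Y.IsSymm) {κ c : ℝ}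
    (hκ : 0 ≤ κ) (hc : 0 < c)
    (h : ∀ Z : Matrix (Fin p) (Fin p) ℝ, Z.PosSemidef → ⟪M, Z⟫_ℝ ≤ κ → -c ≤ ⟪Z, Y⟫_ℝ) :
    (M + (κ / c) • Y).PosSemidef := by
  refine posSemidef_iff.2
    ⟨(isSymm_of_posSemidef hM.posSemidef).add (hY.smul _), fun x => ?_⟩
  rcases eq_or_ne x 0 with rfl | hx
  · simp
  have hMx : 0 < x ⬝ᵥ M *ᵥ x := by simpa using hM.dotProduct_mulVec_pos hx
  have hxx : (vecMulVec x x).PosSemidef := by simpa using posSemidef_vecMulVec_self_star x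
  have hle := h ((κ / (x ⬝ᵥ M *ᵥ x)) • vecMulVec x x) (hxx.smul (by positivity)) (by
    rw [real_inner_smul_right, real_inner_comm, inner_vecMulVec_left, div_mul_cancel₀ _ hMx.ne'])
  rw [real_inner_smul_left, inner_vecMulVec_left, div_mul_eq_mul_div, le_div_iff₀ hMx] at hle
  rw [add_mulVec, dotProduct_add, smul_mulVec, dotProduct_smul, smul_eq_mul, div_mul_eq_mul_div,
    ← sub_neg_eq_add, sub_nonneg, ← neg_div, div_le_iff₀ hc]
  linarith

end Cone

namespace SDP

variable {n m : ℕ} (D : SDP n m)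

theorem inner_adj (y : Fin m → ℝ) (X : Matrix (Fin n) (Fin n) ℝ) :
    ⟪D.adj y, X⟫_ℝ = ∑ i, y i * ⟪D.A i, X⟫_ℝ := by
  simp [adj, sum_inner, real_inner_smul_left]

theorem isSymm_adj (y : Fin m → ℝ) : (D.adj y).IsSymm := by
  rw [Matrix.IsSymm, adj, transpose_sum]
  exact Finset.sum_congr rfl fun i _ => by rw [transpose_smul, (D.A_symm i)]

theorem mem_span_range_A_iff {M : Matrix (Fin n) (Fin n) ℝ} :
    M ∈ Submodule.span ℝ (Set.range D.A) ↔ ∃ y, D.adj y = M :=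
  Submodule.mem_span_range_iff_exists_fun ℝ

variable {D}

theorem inner_C_eq {X Z : Matrix (Fin n) (Fin n) ℝ} {y : Fin m → ℝ} (hX : X ∈ D.affineSet)
    (hZ : Z + D.adj y = D.C) : ⟪D.C, X⟫_ℝ = ⟪Z, X⟫_ℝ + D.b ⬝ᵥ y := by
  rw [← hZ, inner_add_left, inner_adj, dotProduct]
  congr 1
  exact Finset.sum_congr rfl fun i _ => by rw [mul_comm]; exact congrArg (· * y i) (hX.2 i)

theorem add_smul_mem_affineSet {X Y : Matrix (Fin n) (Fin n) ℝ} (hX : X ∈ D.affineSet)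
    (hY : Y.IsSymm) (hAY : ∀ i, ⟪D.A i, Y⟫_ℝ = 0) (s : ℝ) : X + s • Y ∈ D.affineSet := by
  refine ⟨hX.1.add (hY.smul s), fun i => ?_⟩
  rw [innerF_eq_inner, inner_add_right, real_inner_smul_right, hAY, mul_zero, add_zero]
  exact hX.2 i

/- Separates the compact slice `{Z ⪰ 0 | ⟨X₀, Z⟩ ≤ κ}` of the cone from the affine space of dual
slacks. -/
theorem exists_separating_direction {X₀ : Matrix (Fin n) (Fin n) ℝ} (hX₀ : X₀.PosDef) {κ : ℝ}
    (hκ : 0 ≤ κ) (hno : ∀ y, (D.C - D.adj y).PosSemidef → κ < ⟪X₀, D.C - D.adj y⟫_ℝ) :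
    ∃ Y : Matrix (Fin n) (Fin n) ℝ, Y.IsSymm ∧ (∀ i, ⟪D.A i, Y⟫_ℝ = 0) ∧
      ∃ c > 0, ⟪D.C, Y⟫_ℝ < -c ∧
        ∀ Z : Matrix (Fin n) (Fin n) ℝ, Z.PosSemidef → ⟪X₀, Z⟫_ℝ ≤ κ → -c ≤ ⟪Z, Y⟫_ℝ := by
  set B := {Z : Matrix (Fin n) (Fin n) ℝ | Z.PosSemidef ∧ ⟪X₀, Z⟫_ℝ ≤ κ}
  have h0 : (0 : Matrix (Fin n) (Fin n) ℝ) ∈ B := ⟨PosSemidef.zero, by simpa using hκ⟩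
  have hdisj : Disjoint ((fun Z => Z + -D.C) '' B) (Submodule.span ℝ (Set.range D.A)) := by
    rw [Set.disjoint_left]
    rintro _ ⟨Z, hZ, rfl⟩ hmem
    obtain ⟨y, hy⟩ := D.mem_span_range_A_iff.1 (Submodule.neg_mem _ hmem)
    have hZy : D.C - D.adj y = Z := by rw [hy]; simp
    exact (hno y (hZy ▸ hZ.1)).not_ge (hZy ▸ hZ.2)
  obtain ⟨_, ⟨Z₀, hZ₀, rfl⟩, w, hw, hne, horth, hle⟩ :=
    exists_sub_mem_orthogonal_forall_norm_sq_le_inner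
      ((isCompact_setOf_posSemidef_inner_le hX₀ κ).image (continuous_add_const _))
      (by simpa only [add_comm] using (convex_setOf_posSemidef_inner_le κ).translate (-D.C))
      ⟨_, 0, h0, rfl⟩ _ hdisj
  obtain ⟨y, rfl⟩ := D.mem_span_range_A_iff.1 hw
  set Y := Z₀ + -D.C - D.adj y
  have hpos : 0 < ‖Y‖ ^ 2 := by
    have : Y ≠ 0 := sub_ne_zero.2 hne
    positivity
  have hZY : ∀ Z ∈ B, ⟪D.C, Y⟫_ℝ + ‖Y‖ ^ 2 ≤ ⟪Z, Y⟫_ℝ := fun Z hZ => by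
    have h := hle _ ⟨Z, hZ, rfl⟩
    rw [inner_add_left, inner_neg_left] at h
    linarith
  have hCY := hZY 0 h0
  rw [inner_zero_left] at hCY
  refine ⟨Y, ((isSymm_of_posSemidef hZ₀.1).add D.C_symm.neg).sub (D.isSymm_adj y), fun i => ?_,
    -⟪D.C, Y⟫_ℝ - ‖Y‖ ^ 2 / 2, by linarith, by linarith, fun Z hZ hZκ => ?_⟩
  · exact horth _ (Submodule.subset_span ⟨i, rfl⟩)
  · linarith [hZY Z ⟨hZ, hZκ⟩]

theorem exists_dual_ge (hS : ∃ X ∈ D.affineSet, X.PosDef) {v : ℝ}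
    (hv : ∀ X ∈ D.affineSet, X.PosSemidef → v ≤ ⟪D.C, X⟫_ℝ) :
    ∃ y : Fin m → ℝ, (D.C - D.adj y).PosSemidef ∧ v ≤ D.b ⬝ᵥ y := by
  by_contra! hno
  obtain ⟨X₀, hX₀, hpd⟩ := hS
  have hκ : 0 ≤ ⟪D.C, X₀⟫_ℝ - v := sub_nonneg.2 (hv X₀ hX₀ hpd.posSemidef)
  obtain ⟨Y, hY, hAY, c, hc0, hc, hcY⟩ := exists_separating_direction hpd hκ fun y hy => by
    rw [real_inner_comm (D.C - D.adj y) X₀]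
    linarith [hno y hy, inner_C_eq hX₀ (sub_add_cancel D.C (D.adj y))]
  have himprove : ∀ s : ℝ, (X₀ + s • Y).PosSemidef → v ≤ ⟪D.C, X₀⟫_ℝ + s * ⟪D.C, Y⟫_ℝ :=
    fun s hs => by
      simpa only [inner_add_right, real_inner_smul_right] using
        hv _ (add_smul_mem_affineSet hX₀ hY hAY s) hs
  rcases hκ.eq_or_lt with hκ0 | hκ0
  · obtain ⟨s, hs, hps⟩ := exists_pos_posSemidef_add_smul hpd hY
    nlinarith [himprove s hps]
  · have hle := himprove _ (posSemidef_add_smul_of_forall_neg_le_inner hpd hY hκ hc0 hcY)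
    have hlt := mul_lt_mul_of_pos_left hc (div_pos hκ0 hc0)
    rw [mul_neg, div_mul_cancel₀ _ hc0.ne'] at hlt
    linarith

theorem isClosed_affineSet : IsClosed D.affineSet := by
  simp only [affineSet, innerF_eq_inner, Set.ofPred_and, Set.ofPred_forall]
  exact isClosed_setOf_isSymm.inter <| isClosed_iInter fun i =>
    isClosed_eq (continuous_const.inner continuous_id) continuous_const

theorem primalOpt_nonempty (hS : D.Slater) : D.primalOpt.Nonempty := by
  obtain ⟨⟨X₀, hX₀, hpd⟩, y, Z, hZ, hZpd⟩ := hS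
  obtain ⟨X, ⟨⟨hXpsd, -⟩, hX⟩, hmin⟩ :=
    ((isCompact_setOf_posSemidef_inner_le hZpd ⟪Z, X₀⟫_ℝ).inter_right
      isClosed_affineSet).exists_isMinOn ⟨X₀, ⟨hpd.posSemidef, le_rfl⟩, hX₀⟩
      (continuous_const.inner continuous_id : Continuous fun X => ⟪Z, X⟫_ℝ).continuousOn
  refine ⟨X, ⟨hX, hXpsd⟩, fun X' hX' hpsd => ?_⟩
  simp only [innerF_eq_inner, inner_C_eq hX hZ, inner_C_eq hX' hZ, add_le_add_iff_right]
  rcases le_total ⟪Z, X'⟫_ℝ ⟪Z, X₀⟫_ℝ with hle | hle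
  · exact hmin ⟨⟨hpsd, hle⟩, hX'⟩
  · exact (hmin ⟨⟨hpd.posSemidef, le_rfl⟩, hX₀⟩).trans hle

theorem dualOpt_nonempty (hS : D.Slater) : D.dualOpt.Nonempty := by
  obtain ⟨X, hX⟩ := primalOpt_nonempty hS
  obtain ⟨y, hy, hle⟩ := exists_dual_ge hS.1 hX.2
  refine ⟨(y, D.C - D.adj y), ⟨sub_add_cancel _ _, hy⟩, fun y' Z' hZ' hpsd => ?_⟩
  have h := inner_C_eq hX.1.1 hZ'
  rw [innerF_eq_inner] at hle
  exact le_trans (by linarith [inner_nonneg_of_posSemidef hpsd hX.1.2]) hle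

section Optimal

variable {X : Matrix (Fin n) (Fin n) ℝ} {q : (Fin m → ℝ) × Matrix (Fin n) (Fin n) ℝ} {ρ : ℝ}

theorem inner_C_eq_of_mem_opt (hS : D.Slater) (hX : X ∈ D.primalOpt) (hq : q ∈ D.dualOpt) :
    ⟪D.C, X⟫_ℝ = D.b ⬝ᵥ q.1 := by
  obtain ⟨y, hy, hle⟩ := exists_dual_ge hS.1 hX.2
  rw [innerF_eq_inner] at hle
  linarith [hq.2 y _ (sub_add_cancel _ _) hy, inner_C_eq hX.1.1 hq.1.1,
    inner_nonneg_of_posSemidef hq.1.2 hX.1.2]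

theorem inner_eq_zero_of_mem_opt (hS : D.Slater) (hX : X ∈ D.primalOpt) (hq : q ∈ D.dualOpt) :
    ⟪q.2, X⟫_ℝ = 0 := by
  linarith [inner_C_eq_of_mem_opt hS hX hq, inner_C_eq hX.1.1 hq.1.1]

theorem trace_lt_of_mem_dualOpt (hS : ∃ X ∈ D.affineSet, X.PosDef) (hρ : D.dualTraceMax < ρ)
    (hq : q ∈ D.dualOpt) : q.2.trace < ρ := by
  suffices h : BddAbove ((fun p => p.2.trace) '' D.dualOpt) from
    (le_csSup h ⟨q, hq, rfl⟩).trans_lt hρ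
  obtain ⟨X, hX, hpd⟩ := hS
  obtain ⟨c, hc, hcX⟩ := exists_pos_mul_le_rayleigh hpd
  refine ⟨(⟪D.C, X⟫_ℝ - D.b ⬝ᵥ q.1) / c, ?_⟩
  rintro _ ⟨q', hq', rfl⟩
  rw [le_div_iff₀' hc]
  linarith [mul_trace_le_inner_of_le_rayleigh hq'.1.2 hcX, inner_C_eq hX hq'.1.1,
    hq'.2 q.1 q.2 hq.1.1 hq.1.2]

theorem pos_of_dualTraceMax_lt (hρ : D.dualTraceMax < ρ) : 0 < ρ := by
  refine lt_of_le_of_lt (Real.sSup_nonneg ?_) hρ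
  rintro _ ⟨q, hq, rfl⟩
  exact hq.1.2.trace_nonneg

theorem F_eq (X : Matrix (Fin n) (Fin n) ℝ) :
    D.F ρ X = ⟪D.C, X⟫_ℝ + ρ * max (lam (-X) 1) 0 := rfl

theorem F_eq_inner_of_posSemidef (hX : X.PosSemidef) : D.F ρ X = ⟪D.C, X⟫_ℝ := by
  rw [F_eq, max_eq_right (lam_neg_one_nonpos_of_posSemidef hX), mul_zero, add_zero]

theorem add_mul_posPart_le_F (hX : X ∈ D.affineSet) (hq : q ∈ D.dualOpt) :
    D.b ⬝ᵥ q.1 + (ρ - q.2.trace) * max (lam (-X) 1) 0 ≤ D.F ρ X := by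
  have h := inner_nonneg_of_posSemidef hq.1.2 (posSemidef_add_lam_smul_one hX.1)
  rw [inner_add_right, real_inner_smul_right, inner_one_right] at h
  rw [F_eq, inner_C_eq hX hq.1.1]
  linarith

theorem le_F (hS : ∃ X ∈ D.affineSet, X.PosDef) (hρ : D.dualTraceMax < ρ) (hq : q ∈ D.dualOpt)
    (hX : X ∈ D.affineSet) : D.b ⬝ᵥ q.1 ≤ D.F ρ X :=
  le_trans (le_add_of_nonneg_right (mul_nonneg
    (sub_pos.2 (trace_lt_of_mem_dualOpt hS hρ hq)).le (le_max_right _ _)))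
    (add_mul_posPart_le_F hX hq)

theorem mem_primalOpt_iff (hS : D.Slater) (hρ : D.dualTraceMax < ρ) (hq : q ∈ D.dualOpt) :
    X ∈ D.primalOpt ↔ X ∈ D.affineSet ∧ D.F ρ X ≤ D.b ⬝ᵥ q.1 := by
  constructor
  · intro hX
    exact ⟨hX.1.1, by rw [F_eq_inner_of_posSemidef hX.1.2, inner_C_eq_of_mem_opt hS hX hq]⟩
  · rintro ⟨hX, hle⟩
    have hmax : max (lam (-X) 1) 0 ≤ 0 := by
      by_contra! h
      nlinarith [add_mul_posPart_le_F (ρ := ρ) hX hq, trace_lt_of_mem_dualOpt hS.1 hρ hq]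
    have hpsd := posSemidef_of_lam_neg_one_nonpos hX.1 ((le_max_left _ _).trans hmax)
    rw [F_eq_inner_of_posSemidef hpsd] at hle
    obtain ⟨Xs, hXs⟩ := primalOpt_nonempty hS
    refine ⟨⟨hX, hpsd⟩, fun X' hX' hp => (hle.trans ?_).trans (hXs.2 X' hX' hp)⟩
    exact (inner_C_eq_of_mem_opt hS hXs hq).ge

theorem abs_lam_neg_sub_le {Y : Matrix (Fin n) (Fin n) ℝ} (hX : X.IsSymm) (hY : Y.IsSymm)
    (k : ℕ) : |lam (-X) k - lam (-Y) k| ≤ ‖X - Y‖ := by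
  simpa only [neg_sub_neg, norm_sub_rev] using abs_lam_sub_le hX.neg hY.neg k

theorem F_le_add_norm {Y : Matrix (Fin n) (Fin n) ℝ} (hρ : 0 ≤ ρ) (hX : X.IsSymm)
    (hY : Y.IsSymm) : D.F ρ X ≤ D.F ρ Y + (‖D.C‖ + ρ) * ‖X - Y‖ := by
  have hlam := le_of_abs_le ((abs_max_sub_max_le_abs _ _ 0).trans (abs_lam_neg_sub_le hX hY 1))
  have hC := real_inner_le_norm D.C (X - Y)
  rw [inner_sub_right] at hC
  rw [F_eq, F_eq]
  linarith [mul_le_mul_of_nonneg_left hlam hρ]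

theorem continuousOn_lam_neg (k : ℕ) :
    ContinuousOn (fun X : Matrix (Fin n) (Fin n) ℝ => lam (-X) k) {X | X.IsSymm} := by
  refine (LipschitzOnWith.of_dist_le_mul (K := 1) fun X hX Y hY => ?_).continuousOn
  simpa [dist_eq_norm] using abs_lam_neg_sub_le hX hY k

theorem continuousOn_F : ContinuousOn (D.F ρ) D.affineSet := by
  have h : ContinuousOn (fun X : Matrix (Fin n) (Fin n) ℝ => max (lam (-X) 1) 0) D.affineSet :=
    ((continuousOn_lam_neg 1).mono fun X hX => hX.1).sup continuousOn_const
  exact (continuous_const.inner continuous_id).continuousOn.add (h.const_mul ρ)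

theorem exists_norm_le_of_F_le (hS : D.Slater) (hρ : D.dualTraceMax < ρ) (L : ℝ) :
    ∃ B, 0 ≤ B ∧ ∀ X ∈ D.affineSet, D.F ρ X ≤ L → ‖X‖ ≤ B := by
  obtain ⟨q, hq⟩ := dualOpt_nonempty hS
  obtain ⟨y, Z, hZ, hZpd⟩ := hS.2
  set l := (L - D.b ⬝ᵥ q.1) / (ρ - q.2.trace)
  obtain ⟨B, hB⟩ := isBounded_iff_forall_norm_le.1
    (isCompact_setOf_posSemidef_inner_le hZpd (L - D.b ⬝ᵥ y + l * Z.trace)).isBounded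
  refine ⟨max (B + l * ‖(1 : Matrix (Fin n) (Fin n) ℝ)‖) 0, le_max_right _ _,
    fun X hX hF => le_max_of_le_left ?_⟩
  have hpsd := posSemidef_add_lam_smul_one hX.1
  set s := max (lam (-X) 1) 0
  have hs : 0 ≤ s := le_max_right _ _
  have hsl : s ≤ l := by
    rw [le_div_iff₀ (sub_pos.2 (trace_lt_of_mem_dualOpt hS.1 hρ hq))]
    linarith [add_mul_posPart_le_F (ρ := ρ) hX hq]
  have hnorm := hB (X + s • 1) ⟨hpsd, by
    rw [inner_add_right, real_inner_smul_right, inner_one_right]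
    have hC : ⟪D.C, X⟫_ℝ ≤ L :=
      (le_add_of_nonneg_right (mul_nonneg (pos_of_dualTraceMax_lt hρ).le hs)).trans hF
    linarith [inner_C_eq hX hZ, mul_le_mul_of_nonneg_right hsl hZpd.posSemidef.trace_nonneg]⟩
  have htri := norm_sub_le (X + s • 1) (s • (1 : Matrix (Fin n) (Fin n) ℝ))
  rw [add_sub_cancel_right, norm_smul, Real.norm_of_nonneg hs] at htri
  linarith [mul_le_mul_of_nonneg_right hsl (norm_nonneg (1 : Matrix (Fin n) (Fin n) ℝ))]

theorem isCompact_F_sublevel (hS : D.Slater) (hρ : D.dualTraceMax < ρ) (L : ℝ) :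
    IsCompact {X | X ∈ D.affineSet ∧ D.F ρ X ≤ L} := by
  obtain ⟨B, -, hB⟩ := exists_norm_le_of_F_le hS hρ L
  exact Metric.isCompact_of_isClosed_isBounded
    (continuousOn_F.preimage_isClosed_of_isClosed isClosed_affineSet isClosed_Iic)
    (isBounded_iff_forall_norm_le.2 ⟨B, fun X hX => hB X hX.1 hX.2⟩)

theorem isCompact_primalOpt (hS : D.Slater) (hρ : D.dualTraceMax < ρ) :
    IsCompact D.primalOpt := by
  obtain ⟨q, hq⟩ := dualOpt_nonempty hS
  rw [show D.primalOpt = _ from Set.ext fun X => mem_primalOpt_iff hS hρ hq]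
  exact isCompact_F_sublevel hS hρ _

theorem exists_forall_near_primalOpt (hS : D.Slater) (hρ : D.dualTraceMax < ρ)
    (hq : q ∈ D.dualOpt) {d : ℝ} (hd : 0 < d) :
    ∃ ε, 0 < ε ∧ ∀ X ∈ D.affineSet, D.F ρ X ≤ D.b ⬝ᵥ q.1 + ε →
      ∃ Xs ∈ D.primalOpt, ‖X - Xs‖ < d := by
  set v := D.b ⬝ᵥ q.1
  suffices h : ∃ ε, 0 < ε ∧ ∀ X ∈ D.affineSet, D.F ρ X ≤ v + ε →
      X ∈ Metric.thickening d D.primalOpt by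
    simpa only [Metric.mem_thickening_iff, dist_eq_norm] using h
  set K : Set (Matrix (Fin n) (Fin n) ℝ) :=
    {X | X ∈ D.affineSet ∧ D.F ρ X ≤ v + 1} \ Metric.thickening d D.primalOpt
  have hK : IsCompact K := (isCompact_F_sublevel hS hρ _).diff Metric.isOpen_thickening
  rcases K.eq_empty_or_nonempty with hempty | hne
  · exact ⟨1, one_pos, fun X hX hF => Set.sdiff_eq_empty.1 hempty ⟨hX, hF⟩⟩
  · obtain ⟨X₀, ⟨⟨hX₀, -⟩, hfar⟩, hmin⟩ :=
      hK.exists_isMinOn hne (continuousOn_F.mono fun X hX => hX.1.1)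
    have hv : v < D.F ρ X₀ := by
      by_contra! h
      exact hfar (Metric.self_subset_thickening hd _ ((mem_primalOpt_iff hS hρ hq).2 ⟨hX₀, h⟩))
    refine ⟨min 1 ((D.F ρ X₀ - v) / 2), lt_min one_pos (by linarith), fun X hX hF => ?_⟩
    by_contra h
    have hle : D.F ρ X₀ ≤ D.F ρ X :=
      hmin ⟨⟨hX, hF.trans (by linarith [min_le_left 1 ((D.F ρ X₀ - v) / 2)])⟩, h⟩
    linarith [min_le_right 1 ((D.F ρ X₀ - v) / 2)]

end Optimal

end SDP

/-! ### Spectral gap at the primal optima -/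

section EigenGap

variable {p k s : ℕ} {M : Matrix (Fin p) (Fin p) ℝ}

/-- The largest of the first `s` gaps between consecutive eigenvalues of `M`. For `s = 0` it is
`0`, the supremum of the empty set. -/
noncomputable def maxEigenGap (s : ℕ) (M : Matrix (Fin p) (Fin p) ℝ) : ℝ :=
  sSup ((fun r : ℕ => lam M r - lam M (r + 1)) '' Set.Icc 1 s)

theorem maxEigenGap_nonneg (hM : M.IsSymm) (hs : s < p) : 0 ≤ maxEigenGap s M := by
  refine Real.sSup_nonneg ?_
  rintro _ ⟨r, ⟨hr1, hrs⟩, rfl⟩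
  obtain ⟨i, rfl⟩ := Nat.exists_eq_add_of_le' hr1
  exact sub_nonneg.2 (lam_antitone hM i.le_succ (by omega))

theorem maxEigenGap_le (hM : M.IsSymm) (hs : s < p) :
    maxEigenGap s M ≤ lam M 1 - lam M (s + 1) := by
  refine Real.sSup_le ?_ (sub_nonneg.2 (lam_antitone hM s.zero_le hs))
  rintro _ ⟨r, ⟨hr1, hrs⟩, rfl⟩
  obtain ⟨i, rfl⟩ := Nat.exists_eq_add_of_le' hr1
  exact sub_le_sub (lam_antitone hM i.zero_le (by omega)) (lam_antitone hM hrs hs)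

theorem lam_one_sub_lam_le (hk : k ≤ s) : lam M 1 - lam M (k + 1) ≤ k * maxEigenGap s M := by
  induction k with
  | zero => simp
  | succ k ih =>
    have hgap : lam M (k + 1) - lam M (k + 1 + 1) ≤ maxEigenGap s M :=
      le_csSup ((Set.finite_Icc 1 s).image _).bddAbove ⟨k + 1, ⟨by omega, hk⟩, rfl⟩
    push_cast
    linarith [ih (by omega)]

theorem lam_neg_neg_of_finrank_ker_le (hM : M.PosSemidef) (hk : k < p)
    (hker : Module.finrank ℝ (LinearMap.ker M.mulVecLin) ≤ k) : lam (-M) (k + 1) < 0 := by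
  by_contra! hnonneg
  have hsymm := (isSymm_of_posSemidef hM).neg
  obtain ⟨U, hU⟩ := exists_isTopEigenvectors hsymm
  have hV := hU.castLE (k' := k + 1) hk
  set V := U.submatrix id (Fin.castLE (n := k + 1) hk)
  have hzero : ∀ j : Fin (k + 1), lam (-M) (j + 1) = 0 := fun j =>
    ((lam_antitone hsymm (Nat.zero_le j) (by omega)).trans
      (lam_neg_one_nonpos_of_posSemidef hM)).antisymm
      (hnonneg.trans (lam_antitone hsymm (Nat.le_of_lt_succ j.2) hk))
  have hmem : ∀ a, V.mulVecLin a ∈ LinearMap.ker M.mulVecLin := fun a => by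
    have h := hV.mulVec_mulVec a
    simp only [hzero, zero_mul, neg_mulVec] at h
    exact neg_eq_zero.1 (h.trans (mulVec_zero V))
  have hinj : Function.Injective (V.mulVecLin.codRestrict _ hmem) := by
    refine (injective_iff_map_eq_zero _).2 fun a ha => dotProduct_self_eq_zero.1 ?_
    have hVa : V *ᵥ a = 0 := congrArg Subtype.val ha
    rw [← mulVec_dotProduct_mulVec hV.1, hVa, zero_dotProduct]
  have h := LinearMap.finrank_le_finrank_of_injective hinj
  rw [Module.finrank_fin_fun] at h
  omega

end EigenGap

namespace SDP

variable {n m : ℕ} {D : SDP n m} {X : Matrix (Fin n) (Fin n) ℝ} {ρ : ℝ}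

theorem finrank_ker_le_sigmaP (hX : X ∈ D.primalOpt) :
    Module.finrank ℝ (LinearMap.ker X.mulVecLin) ≤ D.sigmaP := by
  refine le_csSup ⟨n, ?_⟩ ⟨X, hX, rfl⟩
  rintro _ ⟨Y, -, rfl⟩
  exact (Submodule.finrank_le _).trans_eq (Module.finrank_fin_fun ℝ)

theorem lam_sigmaP_le_sub_gap (hσ : D.sigmaP < n) (hX : X ∈ D.primalOpt) :
    lam (-X) (D.sigmaP + 1) ≤ lam (-X) 1 - D.gap := by
  have hgap : D.gap ≤ maxEigenGap D.sigmaP (-X) := by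
    refine csInf_le ⟨0, ?_⟩ ⟨X, hX, rfl⟩
    rintro _ ⟨Y, hY, rfl⟩
    exact maxEigenGap_nonneg hY.1.1.1.neg hσ
  linarith [maxEigenGap_le hX.1.1.1.neg hσ]

theorem exists_lam_sigmaP_le_neg (hS : D.Slater) (hρ : D.dualTraceMax < ρ) (hσ : D.sigmaP < n) :
    ∃ g, 0 < g ∧ ∀ X ∈ D.primalOpt, lam (-X) (D.sigmaP + 1) ≤ -g := by
  obtain ⟨X₀, hX₀, hmax⟩ := (isCompact_primalOpt hS hρ).exists_isMaxOn (primalOpt_nonempty hS)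
    ((continuousOn_lam_neg (D.sigmaP + 1)).mono fun X hX => hX.1.1.1)
  have hneg := lam_neg_neg_of_finrank_ker_le hX₀.1.2 hσ (finrank_ker_le_sigmaP hX₀)
  exact ⟨-lam (-X₀) (D.sigmaP + 1), neg_pos.2 hneg, fun X hX => le_neg.2 (neg_le_neg (hmax hX))⟩

theorem lam_neg_one_eq_zero_of_mem_primalOpt (hS : D.Slater)
    (hC : D.C ∉ Submodule.span ℝ (Set.range D.A)) (hX : X ∈ D.primalOpt) : lam (-X) 1 = 0 := by
  obtain ⟨q, hq⟩ := dualOpt_nonempty hS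
  have hZ : q.2 ≠ 0 := fun h => hC <| D.mem_span_range_A_iff.2 ⟨q.1, by
    rw [← hq.1.1, h, zero_add]⟩
  have htr : 0 < q.2.trace :=
    hq.1.2.trace_nonneg.lt_of_ne' (hq.1.2.trace_eq_zero_iff.not.2 hZ)
  have h := mul_trace_le_inner_of_le_rayleigh hq.1.2 (neg_lam_neg_one_mul_le_rayleigh hX.1.1.1)
  rw [inner_eq_zero_of_mem_opt hS hX hq] at h
  exact (lam_neg_one_nonpos_of_posSemidef hX.1.2).antisymm
    (neg_nonpos.1 (nonpos_of_mul_nonpos_left h htr))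

theorem gap_pos (hS : D.Slater) (hρ : D.dualTraceMax < ρ)
    (hC : D.C ∉ Submodule.span ℝ (Set.range D.A)) (hσ : D.sigmaP < n) : 0 < D.gap := by
  obtain ⟨g, hg, hgX⟩ := exists_lam_sigmaP_le_neg hS hρ hσ
  have hle : ∀ X ∈ D.primalOpt, g ≤ D.sigmaP * maxEigenGap D.sigmaP (-X) := fun X hX => by
    linarith [hgX X hX, lam_neg_one_eq_zero_of_mem_primalOpt hS hC hX,
      lam_one_sub_lam_le (M := -X) (le_refl D.sigmaP)]
  have hσ0 : 0 < (D.sigmaP : ℝ) := by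
    obtain ⟨X, hX⟩ := primalOpt_nonempty hS
    have := hg.trans_le (hle X hX)
    exact (Nat.cast_nonneg _).lt_of_ne' fun h => by rw [h, zero_mul] at this; exact this.false
  refine (div_pos hg hσ0).trans_le (le_csInf ((primalOpt_nonempty hS).image _) ?_)
  rintro _ ⟨X, hX, rfl⟩
  exact (div_le_iff₀' hσ0).2 (hle X hX)

end SDP

/-! ### Weight sets and spectral models -/

namespace IsTopEigenvectors

variable {p k : ℕ} {M N : Matrix (Fin p) (Fin p) ℝ} {V : Matrix (Fin p) (Fin k) ℝ} {μ g : ℝ}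

theorem lam_one_le_add_norm (hV : IsTopEigenvectors M V) (hk : 0 < k)
    (hVN : ∀ a, (V *ᵥ a) ⬝ᵥ N *ᵥ (V *ᵥ a) ≤ μ * (a ⬝ᵥ a)) : lam M 1 ≤ μ + ‖N - M‖ := by
  have hN := hVN (Pi.single ⟨0, hk⟩ 1)
  have hE := (abs_le.1 (abs_dotProduct_mulVec_self_le (V.col ⟨0, hk⟩) (N - M))).1
  rw [sub_mulVec, dotProduct_sub, hV.rayleigh_col, hV.dotProduct_col_self, zero_add] at hE
  rw [mulVec_single_one, single_one_dotProduct, Pi.single_eq_same] at hN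
  linarith

/- In the splitting `x = V a + w` with `w` orthogonal to `V`, the cross term involves only `N - M`,
so it is of first order; the gap turns it into a second order term. -/
theorem rayleigh_le_add_sq (hV : IsTopEigenvectors M V) (hM : M.IsSymm) (hN : N.IsSymm)
    (hk : k < p) (hg : 0 < g) (hVN : ∀ a, (V *ᵥ a) ⬝ᵥ N *ᵥ (V *ᵥ a) ≤ μ * (a ⬝ᵥ a))
    (hgap : lam M (k + 1) ≤ μ + ‖N - M‖ - g) (x : Fin p → ℝ) :
    x ⬝ᵥ N *ᵥ x ≤ (μ + 4 / g * ‖N - M‖ ^ 2) * (x ⬝ᵥ x) := by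
  obtain ⟨a, w, hw, rfl⟩ : ∃ a w, Vᵀ *ᵥ w = 0 ∧ x = V *ᵥ a + w :=
    ⟨Vᵀ *ᵥ x, x - V *ᵥ (Vᵀ *ᵥ x), by
      rw [mulVec_sub, Matrix.mulVec_mulVec _ Vᵀ V, hV.1, one_mulVec, sub_self], by abel⟩
  have hcross : 2 * (w ⬝ᵥ N *ᵥ (V *ᵥ a)) ≤ g / 2 * (w ⬝ᵥ w) + 2 / g * ‖N - M‖ ^ 2 * (a ⬝ᵥ a) := by
    have h := two_mul_dotProduct_mulVec_le (half_pos hg) w (V *ᵥ a) (N - M)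
    rw [sub_mulVec, dotProduct_sub, hV.mulVec_mulVec, dotProduct_comm w (V *ᵥ _),
      mulVec_dotProduct_of_orthogonal hw, sub_zero, mulVec_dotProduct_mulVec hV.1] at h
    exact h.trans_eq (by field_simp)
  have hww : w ⬝ᵥ N *ᵥ w ≤ (μ + 2 * ‖N - M‖ - g) * (w ⬝ᵥ w) := by
    have h := (abs_le.1 (abs_dotProduct_mulVec_self_le w (N - M))).2
    rw [sub_mulVec, dotProduct_sub] at h
    linarith [hV.rayleigh_le_of_orthogonal hM hk hw,
      mul_le_mul_of_nonneg_right hgap (dotProduct_self_nonneg w)]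
  have hgap_sq : 2 * ‖N - M‖ - g / 2 ≤ 4 / g * ‖N - M‖ ^ 2 := by
    rw [div_mul_eq_mul_div, le_div_iff₀ hg]
    nlinarith [sq_nonneg (2 * ‖N - M‖ - g / 2)]
  have hexp : (V *ᵥ a + w) ⬝ᵥ N *ᵥ (V *ᵥ a + w) =
      (V *ᵥ a) ⬝ᵥ N *ᵥ (V *ᵥ a) + 2 * (w ⬝ᵥ N *ᵥ (V *ᵥ a)) + w ⬝ᵥ N *ᵥ w := by
    simp only [mulVec_add, add_dotProduct, dotProduct_add,
      dotProduct_mulVec_comm hN (V *ᵥ a) w]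
    ring
  have haa : 0 ≤ 2 / g * ‖N - M‖ ^ 2 * (a ⬝ᵥ a) :=
    mul_nonneg (by positivity) (dotProduct_self_nonneg a)
  rw [hexp, hV.dotProduct_self_add_of_orthogonal hw]
  linarith [hVN a, mul_le_mul_of_nonneg_right hgap_sq (dotProduct_self_nonneg w),
    show 4 / g * ‖N - M‖ ^ 2 * (a ⬝ᵥ a) = 2 * (2 / g * ‖N - M‖ ^ 2 * (a ⬝ᵥ a)) by ring]

end IsTopEigenvectors

namespace SDP

section WeightSet

variable {n r : ℕ} {τ : ℝ} {W Wbar X : Matrix (Fin n) (Fin n) ℝ} {P : Matrix (Fin n) (Fin r) ℝ}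

theorem zero_mem_weightSet (hτ : 0 ≤ τ) : 0 ∈ weightSet τ Wbar P :=
  ⟨0, 0, PosSemidef.zero, le_rfl, by simpa using hτ, by simp⟩

theorem smul_mem_weightSet {c : ℝ} (hc : 0 ≤ c) (hW : W ∈ weightSet τ Wbar P) :
    c • W ∈ weightSet (c * τ) Wbar P := by
  obtain ⟨γ, S, hS, hγ, hle, rfl⟩ := hW
  refine ⟨c * γ, c • S, hS.smul hc, mul_nonneg hc hγ, ?_, ?_⟩
  · rw [trace_smul, smul_eq_mul, ← mul_add]
    exact mul_le_mul_of_nonneg_left hle hc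
  · rw [smul_add, smul_smul, Matrix.mul_smul, Matrix.smul_mul]

theorem convex_weightSet : Convex ℝ (weightSet τ Wbar P) := by
  rintro _ ⟨γ, S, hS, hγ, hle, rfl⟩ _ ⟨γ', S', hS', hγ', hle', rfl⟩ a b ha hb hab
  refine ⟨a * γ + b * γ', a • S + b • S', (hS.smul ha).add (hS'.smul hb), by positivity, ?_, ?_⟩
  · rw [trace_add, trace_smul, trace_smul, smul_eq_mul, smul_eq_mul, ← one_mul τ, ← hab]
    linarith [mul_le_mul_of_nonneg_left hle ha, mul_le_mul_of_nonneg_left hle' hb]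
  · simp only [Matrix.mul_add, Matrix.add_mul, Matrix.mul_smul, Matrix.smul_mul, smul_add, add_smul,
      mul_smul]
    abel

/-- The pairs `(W̄, P)` that the spectral bundle method uses to build its lower models: a density
matrix `W̄` and a matrix `P` with orthonormal columns. -/
structure IsModelData (Wbar : Matrix (Fin n) (Fin n) ℝ) (P : Matrix (Fin n) (Fin r) ℝ) :
    Prop where
  posSemidef : Wbar.PosSemidef
  trace_eq_one : Wbar.trace = 1
  transpose_mul_self : Pᵀ * P = 1

theorem posSemidef_mul_mul_transpose {S : Matrix (Fin r) (Fin r) ℝ} (hS : S.PosSemidef)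
    (P : Matrix (Fin n) (Fin r) ℝ) : (P * S * Pᵀ).PosSemidef := by
  simpa using hS.mul_mul_conjTranspose_same P

theorem trace_mul_mul_transpose (hP : Pᵀ * P = 1) (S : Matrix (Fin r) (Fin r) ℝ) :
    (P * S * Pᵀ).trace = S.trace := by
  rw [Matrix.trace_mul_comm, ← Matrix.mul_assoc, hP, Matrix.one_mul]

theorem smul_vecMulVec_mem_weightSet (hP : Pᵀ * P = 1) {c : ℝ} (hc : 0 ≤ c) {x : Fin n → ℝ}
    (hx : x ∈ LinearMap.range P.mulVecLin) (hτ : c * (x ⬝ᵥ x) ≤ τ) :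
    c • vecMulVec x x ∈ weightSet τ Wbar P := by
  obtain ⟨b, rfl⟩ := hx
  rw [mulVecLin_apply, mulVec_dotProduct_mulVec hP] at hτ
  refine ⟨0, c • vecMulVec b b, Matrix.PosSemidef.smul ?_ hc, le_rfl, ?_, ?_⟩
  · simpa using posSemidef_vecMulVec_self_star b
  · rwa [trace_smul, trace_vecMulVec, zero_add, smul_eq_mul]
  · rw [zero_smul, zero_add, Matrix.mul_smul, Matrix.smul_mul, mulVecLin_apply,
      mul_vecMulVec, vecMulVec_mul, vecMul_transpose]

/-- The largest value of `⟨W, -X⟩` over the weights `W` of total mass at most `1`: the model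
counterpart of `max {λ_max(-X), 0}`. -/
noncomputable def weightMax (Wbar : Matrix (Fin n) (Fin n) ℝ) (P : Matrix (Fin n) (Fin r) ℝ)
    (X : Matrix (Fin n) (Fin n) ℝ) : ℝ :=
  sSup ((fun W => innerF W (-X)) '' weightSet 1 Wbar P)

namespace IsModelData

variable (h : IsModelData Wbar P)

include h

theorem posSemidef_of_mem (hW : W ∈ weightSet τ Wbar P) : W.PosSemidef := by
  obtain ⟨γ, S, hS, hγ, -, rfl⟩ := hW
  exact (h.posSemidef.smul hγ).add (posSemidef_mul_mul_transpose hS P)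

theorem trace_le_of_mem (hW : W ∈ weightSet τ Wbar P) : W.trace ≤ τ := by
  obtain ⟨γ, S, -, -, hle, rfl⟩ := hW
  rwa [trace_add, trace_smul, h.trace_eq_one, trace_mul_mul_transpose h.transpose_mul_self,
    smul_eq_mul, mul_one]

theorem norm_le_of_mem (hW : W ∈ weightSet τ Wbar P) : ‖W‖ ≤ τ :=
  (norm_le_trace_of_posSemidef (h.posSemidef_of_mem hW)).trans (h.trace_le_of_mem hW)

theorem inner_neg_le_posPart (hX : X.IsSymm) (hW : W ∈ weightSet τ Wbar P) :
    ⟪W, -X⟫_ℝ ≤ τ * max (lam (-X) 1) 0 := by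
  have hpsd := h.posSemidef_of_mem hW
  calc ⟪W, -X⟫_ℝ ≤ lam (-X) 1 * W.trace := inner_le_lam_one_mul_trace hpsd hX.neg
    _ ≤ max (lam (-X) 1) 0 * W.trace :=
      mul_le_mul_of_nonneg_right (le_max_left _ _) hpsd.trace_nonneg
    _ ≤ max (lam (-X) 1) 0 * τ :=
      mul_le_mul_of_nonneg_left (h.trace_le_of_mem hW) (le_max_right _ _)
    _ = τ * max (lam (-X) 1) 0 := mul_comm _ _

theorem weightMax_le_posPart (hX : X.IsSymm) : weightMax Wbar P X ≤ max (lam (-X) 1) 0 := by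
  refine csSup_le (Set.Nonempty.image _ ⟨0, zero_mem_weightSet zero_le_one⟩) ?_
  rintro _ ⟨W, hW, rfl⟩
  exact (h.inner_neg_le_posPart hX hW).trans_eq (one_mul _)

theorem inner_neg_le_mul_weightMax (hτ : 0 < τ) (hX : X.IsSymm) (hW : W ∈ weightSet τ Wbar P) :
    ⟪W, -X⟫_ℝ ≤ τ * weightMax Wbar P X := by
  have hmem := smul_mem_weightSet (inv_nonneg.2 hτ.le) hW
  rw [inv_mul_cancel₀ hτ.ne'] at hmem
  have hbdd : BddAbove ((fun W => innerF W (-X)) '' weightSet 1 Wbar P) := by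
    refine ⟨1 * max (lam (-X) 1) 0, ?_⟩
    rintro _ ⟨W', hW', rfl⟩
    exact h.inner_neg_le_posPart hX hW'
  have hle : ⟪τ⁻¹ • W, -X⟫_ℝ ≤ weightMax Wbar P X := le_csSup hbdd ⟨_, hmem, rfl⟩
  rwa [real_inner_smul_left, inv_mul_le_iff₀ hτ] at hle

theorem weightMax_nonneg (hX : X.IsSymm) : 0 ≤ weightMax Wbar P X := by
  simpa using h.inner_neg_le_mul_weightMax one_pos hX (zero_mem_weightSet zero_le_one)

theorem rayleigh_le_weightMax (hX : X.IsSymm) {x : Fin n → ℝ}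
    (hx : x ∈ LinearMap.range P.mulVecLin) : x ⬝ᵥ (-X) *ᵥ x ≤ weightMax Wbar P X * (x ⬝ᵥ x) := by
  rcases eq_or_ne x 0 with rfl | hx0
  · simp
  have hpos := dotProduct_self_pos hx0
  have hle := h.inner_neg_le_mul_weightMax one_pos hX (smul_vecMulVec_mem_weightSet
    h.transpose_mul_self (inv_nonneg.2 hpos.le) hx (inv_mul_cancel₀ hpos.ne').le)
  rwa [real_inner_smul_left, inner_vecMulVec_left, one_mul, inv_mul_le_iff₀ hpos, mul_comm] at hle

theorem posPart_le_weightMax_add {k : ℕ} {Y : Matrix (Fin n) (Fin n) ℝ}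
    {V : Matrix (Fin n) (Fin k) ℝ} {g : ℝ} (hk : 0 < k) (hkn : k < n) (hY : Y.IsSymm)
    (hX : X.IsSymm) (hV : IsTopEigenvectors (-Y) V)
    (hVP : LinearMap.range V.mulVecLin ≤ LinearMap.range P.mulVecLin) (hg : 0 < g)
    (hgap : lam (-Y) (k + 1) ≤ max (lam (-Y) 1) 0 - g) :
    max (lam (-X) 1) 0 ≤ weightMax Wbar P X + 4 / g * ‖X - Y‖ ^ 2 := by
  have hμ := h.weightMax_nonneg hX
  have hV_le : ∀ a, (V *ᵥ a) ⬝ᵥ (-X) *ᵥ (V *ᵥ a) ≤ weightMax Wbar P X * (a ⬝ᵥ a) := fun a => by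
    rw [← mulVec_dotProduct_mulVec hV.1 a a]
    exact h.rayleigh_le_weightMax hX (hVP ⟨a, rfl⟩)
  have hnorm : ‖-X - -Y‖ = ‖X - Y‖ := by rw [neg_sub_neg, norm_sub_rev]
  have hpos : max (lam (-Y) 1) 0 ≤ weightMax Wbar P X + ‖-X - -Y‖ :=
    max_le (hV.lam_one_le_add_norm hk hV_le) (by positivity)
  rw [← hnorm]
  exact max_le (lam_one_le_of_rayleigh_le hX.neg (hk.trans hkn)
    (hV.rayleigh_le_add_sq hY.neg hX.neg hkn hg hV_le (by linarith))) (by positivity)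

end IsModelData

end WeightSet

section Model

variable {n m r : ℕ} {D : SDP n m} {ρ : ℝ} {W Wbar X : Matrix (Fin n) (Fin n) ℝ}
  {P : Matrix (Fin n) (Fin r) ℝ}

theorem model_eq : D.model ρ Wbar P X = ⟪D.C, X⟫_ℝ + ρ * weightMax Wbar P X := rfl

theorem model_le_F (h : IsModelData Wbar P) (hρ : 0 ≤ ρ) (hX : X.IsSymm) :
    D.model ρ Wbar P X ≤ D.F ρ X :=
  add_le_add le_rfl (mul_le_mul_of_nonneg_left (h.weightMax_le_posPart hX) hρ)

theorem inner_sub_le_model (h : IsModelData Wbar P) (hρ : 0 < ρ) (hX : X.IsSymm)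
    (hW : W ∈ weightSet ρ Wbar P) : ⟪D.C - W, X⟫_ℝ ≤ D.model ρ Wbar P X := by
  have hle := h.inner_neg_le_mul_weightMax hρ hX hW
  rw [inner_neg_right] at hle
  rw [model_eq, inner_sub_left]
  linarith

theorem model_le_of_forall_inner_neg_le (hρ : 0 < ρ) {c : ℝ}
    (hc : ∀ W ∈ weightSet ρ Wbar P, ⟪W, -X⟫_ℝ ≤ c) : D.model ρ Wbar P X ≤ ⟪D.C, X⟫_ℝ + c := by
  rw [model_eq, add_le_add_iff_left, ← le_div_iff₀' hρ]
  refine csSup_le (Set.Nonempty.image _ ⟨0, zero_mem_weightSet zero_le_one⟩) ?_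
  rintro _ ⟨W, hW, rfl⟩
  have hle := hc (ρ • W) (by simpa using smul_mem_weightSet hρ.le hW)
  rwa [real_inner_smul_left, ← le_div_iff₀' hρ] at hle

theorem F_le_model_add {k : ℕ} {Y : Matrix (Fin n) (Fin n) ℝ} {V : Matrix (Fin n) (Fin k) ℝ}
    {g : ℝ} (h : IsModelData Wbar P) (hρ : 0 ≤ ρ) (hk : 0 < k) (hkn : k < n) (hY : Y.IsSymm)
    (hX : X.IsSymm) (hV : IsTopEigenvectors (-Y) V)
    (hVP : LinearMap.range V.mulVecLin ≤ LinearMap.range P.mulVecLin) (hg : 0 < g)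
    (hgap : lam (-Y) (k + 1) ≤ max (lam (-Y) 1) 0 - g) :
    D.F ρ X ≤ D.model ρ Wbar P X + ρ * (4 / g) * ‖X - Y‖ ^ 2 := by
  rw [F_eq, model_eq, mul_assoc, add_assoc, ← mul_add]
  gcongr
  exact h.posPart_le_weightMax_add hk hkn hY hX hV hVP hg hgap

end Model

end SDP

/-! ### The master problem -/

theorem nonneg_of_forall_nonneg_quadratic {a c : ℝ}
    (h : ∀ s : ℝ, 0 < s → s ≤ 1 → 0 ≤ s * a + s ^ 2 * c) : 0 ≤ a := by
  by_contra! ha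
  have hc : 0 < c := by linarith [h 1 one_pos le_rfl]
  have hs : 0 < min 1 (-a / (2 * c)) := lt_min one_pos (div_pos (by linarith) (by linarith))
  have hle : min 1 (-a / (2 * c)) * (2 * c) ≤ -a :=
    (le_div_iff₀ (by linarith)).1 (min_le_right _ _)
  nlinarith [h _ hs (min_le_left _ _)]

namespace SDP

section Master

variable {n m r : ℕ} (D : SDP n m) {ρ α : ℝ} {Om W X Wbar : Matrix (Fin n) (Fin n) ℝ}
  {y : Fin m → ℝ} {P : Matrix (Fin n) (Fin r) ℝ}

theorem adj_add_smul (y z : Fin m → ℝ) (s : ℝ) : D.adj (y + s • z) = D.adj y + s • D.adj z := by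
  simp only [adj, Pi.add_apply, Pi.smul_apply, smul_eq_mul, add_smul, Finset.sum_add_distrib,
    Finset.smul_sum, mul_smul]

theorem adj_zero : D.adj 0 = 0 := by simp [adj]

/-- The primal point that a pair `(W, y)` of the dual form of the master problem determines through
the stationarity condition `C - W + α (X - Ω) = 𝒜*(y)`. -/
noncomputable def masterPoint (α : ℝ) (Om W : Matrix (Fin n) (Fin n) ℝ) (y : Fin m → ℝ) :
    Matrix (Fin n) (Fin n) ℝ :=
  Om + α⁻¹ • (W - D.C + D.adj y)

theorem dualMasterObj_add_smul_sub (W H : Matrix (Fin n) (Fin n) ℝ) (y z : Fin m → ℝ) (s : ℝ) :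
    D.dualMasterObj α Om (W + s • H) (y + s • z) - D.dualMasterObj α Om W y =
      s * (⟪H, D.masterPoint α Om W y⟫_ℝ + (⟪D.adj z, D.masterPoint α Om W y⟫_ℝ - D.b ⬝ᵥ z)) +
        s ^ 2 * (1 / (2 * α) * ‖H + D.adj z‖ ^ 2) := by
  set G := W - D.C + D.adj y with hG
  have hline : W + s • H - D.C + D.adj (y + s • z) = G + s • (H + D.adj z) := by
    rw [adj_add_smul, smul_add, hG]; abel
  have hsq : ‖G + s • (H + D.adj z)‖ ^ 2 =
      ‖G‖ ^ 2 + 2 * (s * (⟪G, H⟫_ℝ + ⟪G, D.adj z⟫_ℝ)) + s ^ 2 * ‖H + D.adj z‖ ^ 2 := by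
    rw [norm_add_sq_real, real_inner_smul_right, inner_add_right, norm_smul, mul_pow,
      Real.norm_eq_abs, sq_abs]
  have hpoint : ∀ M, ⟪M, D.masterPoint α Om W y⟫_ℝ = ⟪M, Om⟫_ℝ + α⁻¹ * ⟪G, M⟫_ℝ := fun M => by
    rw [masterPoint, inner_add_right, real_inner_smul_right, real_inner_comm G]
  have hdot : (fun i => D.b i - ⟪D.A i, Om⟫_ℝ) ⬝ᵥ z = D.b ⬝ᵥ z - ⟪D.adj z, Om⟫_ℝ := by
    simp only [dotProduct, inner_adj, sub_mul, Finset.sum_sub_distrib, mul_comm (z _)]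
  simp only [dualMasterObj, innerF_eq_inner, normSqF_eq_norm_sq, hline, ← hG, hsq, hpoint,
    inner_sub_left, inner_add_left, real_inner_smul_left, dotProduct_add, dotProduct_smul, hdot,
    smul_eq_mul]
  ring

variable {D}

theorem inner_adj_eq_of_forall_dualMasterObj_le
    (hopt : ∀ y', D.dualMasterObj α Om W y ≤ D.dualMasterObj α Om W y') (z : Fin m → ℝ) :
    ⟪D.adj z, D.masterPoint α Om W y⟫_ℝ = D.b ⬝ᵥ z := by
  have hnonneg : ∀ z, 0 ≤ ⟪D.adj z, D.masterPoint α Om W y⟫_ℝ - D.b ⬝ᵥ z := fun z => by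
    refine nonneg_of_forall_nonneg_quadratic (c := 1 / (2 * α) * ‖D.adj z‖ ^ 2) fun s _ _ => ?_
    have h := D.dualMasterObj_add_smul_sub (α := α) (Om := Om) W 0 y z s
    rw [smul_zero, add_zero, inner_zero_left, zero_add, zero_add] at h
    exact h ▸ sub_nonneg.2 (hopt _)
  have hneg := hnonneg (-z)
  rw [← zero_add (-z), ← neg_one_smul ℝ z, adj_add_smul, adj_zero, zero_add, zero_add,
    real_inner_smul_left, dotProduct_smul, smul_eq_mul] at hneg
  linarith [hnonneg z]

theorem masterPoint_mem_affineSet (hOm : Om.IsSymm) (hW : W.IsSymm)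
    (hopt : ∀ y', D.dualMasterObj α Om W y ≤ D.dualMasterObj α Om W y') :
    D.masterPoint α Om W y ∈ D.affineSet := by
  refine ⟨hOm.add (((hW.sub D.C_symm).add (D.isSymm_adj y)).smul _), fun i => ?_⟩
  have h := inner_adj_eq_of_forall_dualMasterObj_le hopt (Pi.single i 1)
  rw [inner_adj, dotProduct_single_one] at h
  rw [← h]
  simp [Pi.single_apply, innerF_eq_inner]

theorem inner_neg_masterPoint_le (hW : W ∈ weightSet ρ Wbar P)
    (hopt : ∀ W' ∈ weightSet ρ Wbar P, D.dualMasterObj α Om W y ≤ D.dualMasterObj α Om W' y)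
    {W' : Matrix (Fin n) (Fin n) ℝ} (hW' : W' ∈ weightSet ρ Wbar P) :
    ⟪W', -D.masterPoint α Om W y⟫_ℝ ≤ ⟪W, -D.masterPoint α Om W y⟫_ℝ := by
  suffices 0 ≤ ⟪W' - W, D.masterPoint α Om W y⟫_ℝ by
    rw [inner_sub_left] at this
    rw [inner_neg_right, inner_neg_right]
    linarith
  refine nonneg_of_forall_nonneg_quadratic (c := 1 / (2 * α) * ‖W' - W‖ ^ 2) fun s hs hs1 => ?_
  have h := D.dualMasterObj_add_smul_sub (α := α) (Om := Om) W (W' - W) y 0 s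
  rw [smul_zero, add_zero, adj_zero, inner_zero_left, dotProduct_zero, sub_zero, add_zero,
    add_zero] at h
  exact h ▸ sub_nonneg.2
    (hopt _ (convex_weightSet.add_smul_sub_mem hW hW' ⟨hs.le, hs1⟩))

theorem model_eq_of_forall_inner_neg_le (h : IsModelData Wbar P) (hρ : 0 < ρ) (hX : X.IsSymm)
    (hW : W ∈ weightSet ρ Wbar P) (hmax : ∀ W' ∈ weightSet ρ Wbar P, ⟪W', -X⟫_ℝ ≤ ⟪W, -X⟫_ℝ) :
    D.model ρ Wbar P X = ⟪D.C - W, X⟫_ℝ := by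
  refine le_antisymm ((model_le_of_forall_inner_neg_le hρ hmax).trans_eq ?_)
    (inner_sub_le_model h hρ hX hW)
  rw [inner_sub_left, inner_neg_right, sub_eq_add_neg]

theorem inner_sub_masterPoint_eq (hα : α ≠ 0) (hX : X ∈ D.affineSet)
    (hmem : D.masterPoint α Om W y ∈ D.affineSet) :
    ⟪D.C - W, X - D.masterPoint α Om W y⟫_ℝ =
      α * ⟪Om - D.masterPoint α Om W y, X - D.masterPoint α Om W y⟫_ℝ := by
  have hstat : D.C - W = D.adj y + α • (Om - D.masterPoint α Om W y) := by
    rw [masterPoint, sub_add_cancel_left, smul_neg, smul_smul, mul_inv_cancel₀ hα, one_smul]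
    abel
  have hadj : ⟪D.adj y, X - D.masterPoint α Om W y⟫_ℝ = 0 := by
    rw [inner_sub_right, inner_adj, inner_adj, sub_eq_zero]
    exact Finset.sum_congr rfl fun i _ => congrArg (y i * ·) ((hX.2 i).trans (hmem.2 i).symm)
  conv_lhs => rw [hstat, inner_add_left, hadj, zero_add, real_inner_smul_left]

theorem inner_add_norm_sq_eq {X' : Matrix (Fin n) (Fin n) ℝ}
    (h : ⟪D.C - W, X - X'⟫_ℝ = α * ⟪Om - X', X - X'⟫_ℝ) :
    ⟪D.C - W, X⟫_ℝ + α / 2 * ‖X - Om‖ ^ 2 =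
      ⟪D.C - W, X'⟫_ℝ + α / 2 * ‖X' - Om‖ ^ 2 + α / 2 * ‖X - X'‖ ^ 2 := by
  have hexp := norm_sub_sq_real (X - X') (Om - X')
  rw [sub_sub_sub_cancel_right, real_inner_comm, norm_sub_rev Om X'] at hexp
  rw [inner_sub_right] at h
  rw [hexp]
  linarith

theorem eq_masterPoint_of_isMinOn (h : IsModelData Wbar P) (hρ : 0 < ρ) (hα : 0 < α)
    (hOm : Om.IsSymm) (hW : W ∈ weightSet ρ Wbar P)
    (hopt : ∀ W' ∈ weightSet ρ Wbar P, ∀ y',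
      D.dualMasterObj α Om W y ≤ D.dualMasterObj α Om W' y')
    (hX : X ∈ D.affineSet) (hmin : IsMinOn (D.masterObj ρ α Wbar P Om) D.affineSet X) :
    X = D.masterPoint α Om W y := by
  set X' := D.masterPoint α Om W y
  have hX' : X' ∈ D.affineSet :=
    masterPoint_mem_affineSet hOm (isSymm_of_posSemidef (h.posSemidef_of_mem hW)) (hopt W hW)
  have hmodel : D.model ρ Wbar P X' = ⟪D.C - W, X'⟫_ℝ := model_eq_of_forall_inner_neg_le h hρ
    hX'.1 hW fun _ => inner_neg_masterPoint_le hW fun _ hW'' => hopt _ hW'' y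
  have hle : D.model ρ Wbar P X + α / 2 * ‖X - Om‖ ^ 2 ≤
      D.model ρ Wbar P X' + α / 2 * ‖X' - Om‖ ^ 2 := by
    simpa only [Set.mem_ofPred_eq, masterObj, normSqF_eq_norm_sq] using hmin hX'
  have hdist : α / 2 * ‖X - X'‖ ^ 2 ≤ 0 := by
    linarith [inner_add_norm_sq_eq (inner_sub_masterPoint_eq hα.ne' hX hX'),
      inner_sub_le_model (D := D) h hρ hX.1 hW]
  have hsq : ‖X - X'‖ ^ 2 ≤ 0 := nonpos_of_mul_nonpos_right hdist (half_pos hα)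
  exact sub_eq_zero.1 (norm_eq_zero.1 (pow_eq_zero_iff two_ne_zero |>.1
    (hsq.antisymm (sq_nonneg _))))

end Master

end SDP

/-! ### Runs of the bundle method -/

section Blocks

variable {p k r l : ℕ}

theorem mul_mul_transpose_eq_of_range_le {P : Matrix (Fin p) (Fin r) ℝ} (hP : Pᵀ * P = 1)
    {B : Matrix (Fin p) (Fin k) ℝ}
    (hB : LinearMap.range B.mulVecLin ≤ LinearMap.range P.mulVecLin)
    (S : Matrix (Fin k) (Fin k) ℝ) : P * (Pᵀ * B * S * (Pᵀ * B)ᵀ) * Pᵀ = B * S * Bᵀ := by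
  have hPB : P * (Pᵀ * B) = B := by
    refine Matrix.ext_of_mulVec_single fun i => ?_
    obtain ⟨b, hb⟩ := hB ⟨Pi.single i 1, rfl⟩
    rw [mulVecLin_apply, mulVecLin_apply] at hb
    rw [← Matrix.mulVec_mulVec, ← Matrix.mulVec_mulVec, ← hb, Matrix.mulVec_mulVec b Pᵀ P, hP,
      one_mulVec]
  calc P * (Pᵀ * B * S * (Pᵀ * B)ᵀ) * Pᵀ = P * (Pᵀ * B) * S * (P * (Pᵀ * B))ᵀ := by
        rw [transpose_mul P]
        simp only [Matrix.mul_assoc]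
    _ = B * S * Bᵀ := by rw [hPB]

theorem mul_diagonal_mul_transpose_eq_add (Q : Matrix (Fin p) (Fin (k + l)) ℝ)
    (d : Fin (k + l) → ℝ) :
    Q * diagonal d * Qᵀ =
      Q.submatrix id (Fin.castAdd l) * diagonal (fun j => d (Fin.castAdd l j)) *
        (Q.submatrix id (Fin.castAdd l))ᵀ +
      Q.submatrix id (Fin.natAdd k) * diagonal (fun j => d (Fin.natAdd k j)) *
        (Q.submatrix id (Fin.natAdd k))ᵀ := by
  ext i j
  rw [Matrix.add_apply, Matrix.mul_apply, Matrix.mul_apply, Matrix.mul_apply, Fin.sum_univ_add]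
  simp [mul_diagonal]

theorem transpose_mul_submatrix_eq_one {Q : Matrix (Fin p) (Fin r) ℝ} (hQ : Qᵀ * Q = 1)
    {f : Fin l → Fin r} (hf : Function.Injective f) :
    (Q.submatrix id f)ᵀ * Q.submatrix id f = 1 := by
  ext i j
  simpa [Matrix.mul_apply, Matrix.one_apply, hf.eq_iff] using congrFun (congrFun hQ (f i)) (f j)

end Blocks

namespace SDP.Run

variable {n m : ℕ} {D : SDP n m} {ρ α β : ℝ} {rp rc : ℕ} {Om0 : Matrix (Fin n) (Fin n) ℝ}
  (R : D.Run ρ α β rp rc Om0) (t : ℕ)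

/-- The weight `W_t*` of the solution of the dual form of the master problem. -/
noncomputable def W : Matrix (Fin n) (Fin n) ℝ :=
  R.γ t • R.Wbar t + R.P t * R.S t * (R.P t)ᵀ

/-- The part `P_t Q₁ Σ₁ Q₁ᵀ P_tᵀ` of `W_t*`, which the span of `P_{t+1}` still represents. -/
noncomputable def kept : Matrix (Fin n) (Fin n) ℝ :=
  R.P t * (R.Q t).submatrix id (Fin.castAdd rc) *
    diagonal (fun j : Fin rp => lam (R.S t) ((j : ℕ) + 1)) *
    (R.P t * (R.Q t).submatrix id (Fin.castAdd rc))ᵀ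

/-- The part `P_t Q₂ Σ₂ Q₂ᵀ P_tᵀ` of `W_t*`, which is aggregated into `W̄_{t+1}`. -/
noncomputable def dropped : Matrix (Fin n) (Fin n) ℝ :=
  R.P t * ((R.Q t).submatrix id (Fin.natAdd rp) *
    diagonal (fun j : Fin rc => lam (R.S t) (rp + (j : ℕ) + 1)) *
    ((R.Q t).submatrix id (Fin.natAdd rp))ᵀ) * (R.P t)ᵀ

/-- The mass `γ_t* + tr Σ₂` aggregated into `W̄_{t+1}`. -/
noncomputable def mass : ℝ := R.γ t + ∑ j : Fin rc, lam (R.S t) (rp + (j : ℕ) + 1)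

theorem transpose_mul_P : (R.P t)ᵀ * R.P t = 1 := by
  cases t with
  | zero => exact R.P_zero.1
  | succ t => exact R.P_orth t

theorem mul_S_mul_transpose_eq_add :
    R.P t * R.S t * (R.P t)ᵀ = R.kept t + R.dropped t := by
  conv_lhs => rw [(R.Q_eig t).eq_mul_diagonal_mul_transpose, mul_diagonal_mul_transpose_eq_add]
  rw [kept, dropped, Matrix.mul_add, Matrix.add_mul, transpose_mul]
  simp only [Matrix.mul_assoc, Fin.val_castAdd, Fin.val_natAdd]

theorem posSemidef_dropped : (R.dropped t).PosSemidef :=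
  posSemidef_mul_mul_transpose (posSemidef_mul_mul_transpose
    (PosSemidef.diagonal fun _ => lam_nonneg_of_posSemidef (R.S_psd t) _) _) _

theorem mass_eq : R.mass t = R.γ t + (R.dropped t).trace := by
  rw [mass, dropped, trace_mul_mul_transpose (R.transpose_mul_P t), trace_mul_mul_transpose
    (transpose_mul_submatrix_eq_one (R.Q_eig t).1 (Fin.natAdd_injective _ _)), trace_diagonal]

theorem mass_nonneg : 0 ≤ R.mass t :=
  R.mass_eq t ▸ add_nonneg (R.γ_nonneg t) (R.posSemidef_dropped t).trace_nonneg

theorem Wbar_succ_eq (h : R.mass t ≠ 0) :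
    R.Wbar (t + 1) = (R.mass t)⁻¹ • (R.γ t • R.Wbar t + R.dropped t) :=
  R.Wbar_succ t h

theorem isModelData : IsModelData (R.Wbar t) (R.P t) := by
  induction t with
  | zero => exact ⟨R.Wbar_zero.1, R.Wbar_zero.2, R.P_zero.1⟩
  | succ t ih =>
    by_cases h : R.mass t = 0
    · exact ⟨(R.Wbar_succ_zero t h).1, (R.Wbar_succ_zero t h).2, R.P_orth t⟩
    · refine ⟨?_, ?_, R.P_orth t⟩ <;> rw [R.Wbar_succ_eq t h]
      · exact ((ih.posSemidef.smul (R.γ_nonneg t)).add (R.posSemidef_dropped t)).smul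
          (inv_nonneg.2 (R.mass_nonneg t))
      · rw [trace_smul, trace_add, trace_smul, ih.trace_eq_one, smul_eq_mul, smul_eq_mul, mul_one,
          ← R.mass_eq, inv_mul_cancel₀ h]

theorem mass_smul_Wbar_succ :
    R.mass t • R.Wbar (t + 1) = R.γ t • R.Wbar t + R.dropped t := by
  by_cases h : R.mass t = 0
  · have htr := (R.posSemidef_dropped t).trace_nonneg
    have hsum := R.mass_eq t
    have hγ : R.γ t = 0 := by linarith [R.γ_nonneg t]
    have hdropped : R.dropped t = 0 := (R.posSemidef_dropped t).trace_eq_zero_iff.1 (by linarith)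
    rw [h, hγ, hdropped, zero_smul, zero_smul, zero_add]
  · rw [R.Wbar_succ_eq t h, smul_smul, mul_inv_cancel₀ h, one_smul]

theorem W_mem_weightSet : R.W t ∈ weightSet ρ (R.Wbar t) (R.P t) :=
  ⟨R.γ t, R.S t, R.S_psd t, R.γ_nonneg t, R.coeff_le t, rfl⟩

variable {t} in
theorem norm_C_sub_le {W : Matrix (Fin n) (Fin n) ℝ} (hW : W ∈ weightSet ρ (R.Wbar t) (R.P t)) :
    ‖D.C - W‖ ≤ ‖D.C‖ + ρ :=
  (norm_sub_le _ _).trans (add_le_add_right ((R.isModelData t).norm_le_of_mem hW) _)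

theorem W_mem_weightSet_succ : R.W t ∈ weightSet ρ (R.Wbar (t + 1)) (R.P (t + 1)) := by
  set B := R.P t * (R.Q t).submatrix id (Fin.castAdd rc)
  set Λ : Matrix (Fin rp) (Fin rp) ℝ := diagonal fun j => lam (R.S t) ((j : ℕ) + 1)
  have hkept : R.P (t + 1) * ((R.P (t + 1))ᵀ * B * Λ * ((R.P (t + 1))ᵀ * B)ᵀ) * (R.P (t + 1))ᵀ =
      R.kept t := mul_mul_transpose_eq_of_range_le (R.P_orth t) (R.P_span_past t) Λ
  refine ⟨R.mass t, (R.P (t + 1))ᵀ * B * Λ * ((R.P (t + 1))ᵀ * B)ᵀ, posSemidef_mul_mul_transpose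
    (PosSemidef.diagonal fun _ => lam_nonneg_of_posSemidef (R.S_psd t) _) _, R.mass_nonneg t,
    ?_, ?_⟩
  · have htr := congrArg trace (R.mul_S_mul_transpose_eq_add t)
    rw [trace_mul_mul_transpose (R.transpose_mul_P t), trace_add] at htr
    rw [← trace_mul_mul_transpose (R.P_orth t), hkept, mass_eq]
    linarith [R.coeff_le t]
  · rw [hkept, R.mass_smul_Wbar_succ, W, R.mul_S_mul_transpose_eq_add]
    abel

theorem exists_mem_weightSet_succ_inner_eq_F (hrc : 0 < rc) (hρ : 0 ≤ ρ) :
    ∃ W ∈ weightSet ρ (R.Wbar (t + 1)) (R.P (t + 1)),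
      ⟪D.C - W, R.cand (t + 1)⟫_ℝ = D.F ρ (R.cand (t + 1)) := by
  by_cases h : 0 ≤ lam (-R.cand (t + 1)) 1
  · have hcol := (R.V_eig t).dotProduct_col_self ⟨0, hrc⟩
    have hray := (R.V_eig t).rayleigh_col ⟨0, hrc⟩
    refine ⟨ρ • vecMulVec _ _, smul_vecMulVec_mem_weightSet (R.P_orth t) hρ (R.P_span_current t
      ⟨Pi.single ⟨0, hrc⟩ 1, by rw [mulVecLin_apply, mulVec_single_one]⟩) (by simp [hcol]), ?_⟩
    rw [neg_mulVec, dotProduct_neg, zero_add] at hray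
    rw [inner_sub_left, real_inner_smul_left, inner_vecMulVec_left, F_eq, max_eq_left h, ← hray]
    ring
  · exact ⟨0, zero_mem_weightSet hρ, by
      rw [sub_zero, F_eq, max_eq_right (le_of_not_ge h), mul_zero, add_zero]⟩

/-- The test that triggers a descent step at iteration `t`. -/
def IsDescent : Prop :=
  β * (D.F ρ (R.Om t) - D.model ρ (R.Wbar t) (R.P t) (R.cand (t + 1))) ≤
    D.F ρ (R.Om t) - D.F ρ (R.cand (t + 1))

theorem Om_succ_eq_or :
    R.Om (t + 1) = R.cand (t + 1) ∨
      ((t ≠ 0 ∨ R.Om 0 ∈ D.affineSet) ∧ ¬ R.IsDescent t ∧ R.Om (t + 1) = R.Om t) := by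
  by_cases h : t ≠ 0 ∨ R.Om 0 ∈ D.affineSet
  · by_cases hdesc : R.IsDescent t
    · exact .inl (R.step_descent t h hdesc)
    · exact .inr ⟨h, hdesc, R.step_null t h hdesc⟩
  · push Not at h
    obtain ⟨rfl, h0⟩ := h
    exact .inl (R.step_affine h0)

variable {t}

theorem Om_mem_affineSet (ht : t ≠ 0 ∨ R.Om 0 ∈ D.affineSet) : R.Om t ∈ D.affineSet := by
  induction t with
  | zero => simpa using ht
  | succ t ih =>
    rcases R.Om_succ_eq_or t with h | ⟨ht', -, h⟩
    · exact h ▸ R.cand_mem t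
    · exact h ▸ ih ht'

theorem isSymm_Om (hOm0 : Om0.IsSymm) : (R.Om t).IsSymm := by
  by_cases ht : t = 0
  · rwa [ht, R.Om_zero]
  · exact (R.Om_mem_affineSet (.inl ht)).1

section Proximal

variable (t) (hOm0 : Om0.IsSymm) (hρ : 0 < ρ) (hα : 0 < α) {X : Matrix (Fin n) (Fin n) ℝ}

include hOm0 hρ hα

theorem cand_succ_eq_masterPoint :
    R.cand (t + 1) = D.masterPoint α (R.Om t) (R.W t) (R.y t) :=
  eq_masterPoint_of_isMinOn (R.isModelData t) hρ hα (R.isSymm_Om hOm0) (R.W_mem_weightSet t)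
    (R.dual_opt t) (R.cand_mem t) (R.cand_opt t)

theorem model_cand_succ : D.model ρ (R.Wbar t) (R.P t) (R.cand (t + 1)) =
    ⟪D.C - R.W t, R.cand (t + 1)⟫_ℝ := by
  refine model_eq_of_forall_inner_neg_le (R.isModelData t) hρ (R.cand_mem t).1
    (R.W_mem_weightSet t) fun W hW => ?_
  rw [R.cand_succ_eq_masterPoint t hOm0 hρ hα]
  exact inner_neg_masterPoint_le (R.W_mem_weightSet t) (fun W' hW' => R.dual_opt t W' hW' _) hW

theorem inner_sub_cand_succ (hX : X ∈ D.affineSet) :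
    ⟪D.C - R.W t, X - R.cand (t + 1)⟫_ℝ =
      α * ⟪R.Om t - R.cand (t + 1), X - R.cand (t + 1)⟫_ℝ := by
  have hmem := R.cand_mem t
  rw [R.cand_succ_eq_masterPoint t hOm0 hρ hα] at hmem ⊢
  exact inner_sub_masterPoint_eq hα.ne' hX hmem

/- The candidate is the projection of `Ω_t - α⁻¹ (C - W_t)` onto the affine set. -/
theorem norm_sub_cand_succ_le (hX : X ∈ D.affineSet) :
    ‖X - R.cand (t + 1)‖ ≤ ‖X - R.Om t‖ + (‖D.C‖ + ρ) / α := by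
  set Y := R.cand (t + 1)
  rcases (norm_nonneg (X - Y)).eq_or_lt with h0 | hpos
  · rw [← h0]; positivity
  have hsplit : X - Y = (X - R.Om t) + (R.Om t - Y) := by abel
  have hOm : α * ⟪X - R.Om t, X - Y⟫_ℝ ≤ α * (‖X - R.Om t‖ * ‖X - Y‖) :=
    mul_le_mul_of_nonneg_left (real_inner_le_norm _ _) hα.le
  have hW : ⟪D.C - R.W t, X - Y⟫_ℝ ≤ (‖D.C‖ + ρ) * ‖X - Y‖ := (real_inner_le_norm _ _).trans
    (mul_le_mul_of_nonneg_right (R.norm_C_sub_le (R.W_mem_weightSet t)) (norm_nonneg _))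
  rw [R.inner_sub_cand_succ t hOm0 hρ hα hX] at hW
  have hsq : α * ‖X - Y‖ ^ 2 = α * ⟪X - R.Om t, X - Y⟫_ℝ + α * ⟪R.Om t - Y, X - Y⟫_ℝ := by
    rw [← mul_add, ← inner_add_left, ← hsplit, real_inner_self_eq_norm_sq]
  refine le_of_mul_le_mul_right ?_ (mul_pos hα hpos)
  have hdiv : (‖D.C‖ + ρ) / α * (α * ‖X - Y‖) = (‖D.C‖ + ρ) * ‖X - Y‖ := by field_simp
  rw [add_mul, hdiv]
  linarith

theorem norm_cand_succ_sub_Om_le (ht : t ≠ 0 ∨ R.Om 0 ∈ D.affineSet) :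
    ‖R.cand (t + 1) - R.Om t‖ ≤ (‖D.C‖ + ρ) / α := by
  simpa [norm_sub_rev] using R.norm_sub_cand_succ_le t hOm0 hρ hα (R.Om_mem_affineSet ht)

end Proximal

end SDP.Run

/-! ### Descent and null steps -/

namespace SDP.Run

variable {n m : ℕ} {D : SDP n m} {ρ α β : ℝ} {rp rc : ℕ} {Om0 : Matrix (Fin n) (Fin n) ℝ}
  (R : D.Run ρ α β rp rc Om0) {t : ℕ} {X : Matrix (Fin n) (Fin n) ℝ}

/-- The optimal value of the master problem at iteration `t`, where by `model_cand_succ` the model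
is replaced with the affine function of `W_t*`. -/
noncomputable def proxVal (t : ℕ) : ℝ :=
  ⟪D.C - R.W t, R.cand (t + 1)⟫_ℝ + α / 2 * ‖R.cand (t + 1) - R.Om t‖ ^ 2

theorem inner_C_sub_W_le_F (hρ : 0 < ρ) (hX : X.IsSymm) : ⟪D.C - R.W t, X⟫_ℝ ≤ D.F ρ X :=
  (inner_sub_le_model (R.isModelData t) hρ hX (R.W_mem_weightSet t)).trans
    (model_le_F (R.isModelData t) hρ.le hX)

section Steps

variable (hOm0 : Om0.IsSymm) (hρ : 0 < ρ) (hα : 0 < α)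

include hOm0 hρ hα

theorem proxVal_add_norm_sq_eq (hX : X ∈ D.affineSet) :
    R.proxVal t + α / 2 * ‖X - R.cand (t + 1)‖ ^ 2 =
      ⟪D.C - R.W t, X⟫_ℝ + α / 2 * ‖X - R.Om t‖ ^ 2 :=
  (inner_add_norm_sq_eq (R.inner_sub_cand_succ t hOm0 hρ hα hX)).symm

theorem model_cand_succ_eq_proxVal_sub : D.model ρ (R.Wbar t) (R.P t) (R.cand (t + 1)) =
    R.proxVal t - α / 2 * ‖R.cand (t + 1) - R.Om t‖ ^ 2 := by
  rw [R.model_cand_succ t hOm0 hρ hα, proxVal, add_sub_cancel_right]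

theorem mul_norm_sq_le_F_sub_model (ht : t ≠ 0 ∨ R.Om 0 ∈ D.affineSet) :
    α * ‖R.cand (t + 1) - R.Om t‖ ^ 2 ≤
      D.F ρ (R.Om t) - D.model ρ (R.Wbar t) (R.P t) (R.cand (t + 1)) := by
  have hOm := R.Om_mem_affineSet ht
  have hval := R.proxVal_add_norm_sq_eq (t := t) hOm0 hρ hα hOm
  rw [sub_self, norm_zero, norm_sub_rev] at hval
  rw [R.model_cand_succ_eq_proxVal_sub hOm0 hρ hα]
  linarith [R.inner_C_sub_W_le_F (t := t) hρ hOm.1]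

theorem F_Om_succ_le (hβ : 0 ≤ β) (ht : t ≠ 0 ∨ R.Om 0 ∈ D.affineSet) :
    D.F ρ (R.Om (t + 1)) ≤ D.F ρ (R.Om t) := by
  by_cases hdesc : R.IsDescent t
  · have hgain : 0 ≤ D.F ρ (R.Om t) - D.model ρ (R.Wbar t) (R.P t) (R.cand (t + 1)) :=
      le_trans (by positivity) (R.mul_norm_sq_le_F_sub_model hOm0 hρ hα ht)
    have hdec : β * _ ≤ D.F ρ (R.Om t) - _ := hdesc
    rw [R.step_descent t ht hdesc]
    linarith [mul_nonneg hβ hgain]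
  · rw [R.step_null t ht hdesc]

theorem proxVal_le_of_mem_Icc (ht : t ≠ 0 ∨ R.Om 0 ∈ D.affineSet) (hX : X ∈ D.affineSet) {s : ℝ}
    (hs : s ∈ Set.Icc 0 1) : R.proxVal t ≤
      D.F ρ (R.Om t) - s * (D.F ρ (R.Om t) - D.F ρ X) + α / 2 * (s * ‖X - R.Om t‖) ^ 2 := by
  have hOm := R.Om_mem_affineSet ht
  have hdir (i : Fin m) : ⟪D.A i, X - R.Om t⟫_ℝ = 0 := by
    rw [inner_sub_right, sub_eq_zero]
    exact (hX.2 i).trans (hOm.2 i).symm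
  have hval := R.proxVal_add_norm_sq_eq (t := t) hOm0 hρ hα
    (add_smul_mem_affineSet hOm (hX.1.sub hOm.1) hdir s)
  rw [add_sub_cancel_left, norm_smul, Real.norm_of_nonneg hs.1, inner_add_right,
    real_inner_smul_right, inner_sub_right] at hval
  have hFOm := mul_le_mul_of_nonneg_left (R.inner_C_sub_W_le_F (t := t) hρ hOm.1)
    (sub_nonneg.2 hs.2)
  have hFX := mul_le_mul_of_nonneg_left (R.inner_C_sub_W_le_F (t := t) hρ hX.1) hs.1
  have hprox : 0 ≤ α / 2 * ‖R.Om t + s • (X - R.Om t) - R.cand (t + 1)‖ ^ 2 := by positivity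
  linarith

theorem proxVal_le_F_Om (ht : t ≠ 0 ∨ R.Om 0 ∈ D.affineSet) : R.proxVal t ≤ D.F ρ (R.Om t) := by
  simpa using R.proxVal_le_of_mem_Icc hOm0 hρ hα ht (R.Om_mem_affineSet ht)
    (Set.left_mem_Icc.2 zero_le_one)

theorem inner_add_norm_sq_le_proxVal_succ (hnull : R.Om (t + 1) = R.Om t)
    {W : Matrix (Fin n) (Fin n) ℝ} (hW : W ∈ weightSet ρ (R.Wbar (t + 1)) (R.P (t + 1))) :
    ⟪D.C - W, R.cand (t + 2)⟫_ℝ + α / 2 * ‖R.cand (t + 2) - R.Om t‖ ^ 2 ≤ R.proxVal (t + 1) := by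
  have hmodel := inner_sub_le_model (D := D) (R.isModelData (t + 1)) hρ (R.cand_mem (t + 1)).1 hW
  rw [R.model_cand_succ_eq_proxVal_sub hOm0 hρ hα, hnull] at hmodel
  exact le_sub_iff_add_le.1 hmodel

theorem proxVal_add_norm_sq_le_succ (hnull : R.Om (t + 1) = R.Om t) :
    R.proxVal t + α / 2 * ‖R.cand (t + 2) - R.cand (t + 1)‖ ^ 2 ≤ R.proxVal (t + 1) :=
  (R.proxVal_add_norm_sq_eq hOm0 hρ hα (R.cand_mem (t + 1))).trans_le
    (R.inner_add_norm_sq_le_proxVal_succ hOm0 hρ hα hnull (R.W_mem_weightSet_succ t))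

/- The next model contains an affine function that is exact for `F` at the rejected candidate. -/
theorem proxVal_add_F_sub_model_le_succ (hrc : 0 < rc) (hnull : R.Om (t + 1) = R.Om t) :
    R.proxVal t +
        (D.F ρ (R.cand (t + 1)) - D.model ρ (R.Wbar t) (R.P t) (R.cand (t + 1))) -
        2 * (‖D.C‖ + ρ) * ‖R.cand (t + 2) - R.cand (t + 1)‖ ≤ R.proxVal (t + 1) := by
  set X := R.cand (t + 1)
  set Z := R.cand (t + 2)
  obtain ⟨W', hW', hactive⟩ := R.exists_mem_weightSet_succ_inner_eq_F t hrc hρ.le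
  have hnext : ⟪D.C - W', Z⟫_ℝ + α / 2 * ‖Z - R.Om t‖ ^ 2 ≤ R.proxVal (t + 1) :=
    R.inner_add_norm_sq_le_proxVal_succ hOm0 hρ hα hnull hW'
  have hcut : -((‖D.C‖ + ρ) * ‖Z - X‖) ≤ ⟪D.C - W', Z - X⟫_ℝ :=
    neg_le_of_abs_le ((abs_real_inner_le_norm _ _).trans
      (mul_le_mul_of_nonneg_right (R.norm_C_sub_le hW') (norm_nonneg _)))
  have hW : ⟪D.C - R.W t, Z - X⟫_ℝ ≤ (‖D.C‖ + ρ) * ‖Z - X‖ := (real_inner_le_norm _ _).trans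
    (mul_le_mul_of_nonneg_right (R.norm_C_sub_le (R.W_mem_weightSet t)) (norm_nonneg _))
  have hprox := R.proxVal_add_norm_sq_eq (t := t) hOm0 hρ hα (R.cand_mem (t + 1))
  have hval : ⟪D.C - R.W t, X⟫_ℝ = D.model ρ (R.Wbar t) (R.P t) X :=
    (R.model_cand_succ t hOm0 hρ hα).symm
  have hsq : 0 ≤ α / 2 * ‖Z - X‖ ^ 2 := by positivity
  rw [inner_sub_right] at hcut hW
  change ⟪D.C - W', X⟫_ℝ = D.F ρ X at hactive
  linarith

theorem proxVal_add_min_le_succ (hrc : 0 < rc) (hnull : R.Om (t + 1) = R.Om t) {τ : ℝ}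
    (hτ : 0 < τ)
    (hgap : τ ≤ D.F ρ (R.cand (t + 1)) - D.model ρ (R.Wbar t) (R.P t) (R.cand (t + 1))) :
    R.proxVal t + min (τ / 2) (α / 2 * (τ / (4 * (‖D.C‖ + ρ))) ^ 2) ≤ R.proxVal (t + 1) := by
  set d := ‖R.cand (t + 2) - R.cand (t + 1)‖
  have hM : 0 < 4 * (‖D.C‖ + ρ) := by positivity
  rcases le_total d (τ / (4 * (‖D.C‖ + ρ))) with hnear | hfar
  · have hcut := R.proxVal_add_F_sub_model_le_succ hOm0 hρ hα hrc hnull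
    rw [le_div_iff₀ hM] at hnear
    linarith [min_le_left (τ / 2) (α / 2 * (τ / (4 * (‖D.C‖ + ρ))) ^ 2)]
  · calc R.proxVal t + min (τ / 2) (α / 2 * (τ / (4 * (‖D.C‖ + ρ))) ^ 2)
        ≤ R.proxVal t + α / 2 * d ^ 2 := by
          gcongr
          exact (min_le_right _ _).trans (by gcongr)
      _ ≤ R.proxVal (t + 1) := R.proxVal_add_norm_sq_le_succ hOm0 hρ hα hnull

end Steps

end SDP.Run

/-! ### Convergence of the cost -/

section Potential

variable {f w : ℕ → ℝ} {v L ε c κ U : ℝ}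

/- The potential `(1 + (U + κ) / c) f - w` drops by `κ` at either kind of step. -/
theorem potential_le_of_forall_step (hc : 0 < c) (hκ : 0 ≤ κ) (hU : 0 ≤ U)
    (hwf : ∀ t, w t ≤ f t) (hfw : ∀ t, f t ≤ w t + U) {N : ℕ}
    (hstep : ∀ t < N, f (t + 1) ≤ f t - c ∨ (f (t + 1) = f t ∧ w t + κ ≤ w (t + 1))) :
    (1 + (U + κ) / c) * f N - w N ≤ (1 + (U + κ) / c) * f 0 - w 0 - N * κ := by
  induction N with
  | zero => simp
  | succ N ih =>
    have hN := ih fun t ht => hstep t (ht.trans N.lt_succ_self)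
    have hcancel : (U + κ) / c * c = U + κ := div_mul_cancel₀ _ hc.ne'
    push_cast
    rcases hstep N N.lt_succ_self with hdescent | ⟨heq, hnull⟩
    · have hdrop := mul_le_mul_of_nonneg_left hdescent
        (show 0 ≤ (U + κ) / c by positivity)
      linarith [hwf N, hfw (N + 1)]
    · rw [heq]
      linarith

theorem exists_forall_le_of_potential (v L ε : ℝ) (hc : 0 < c) (hκ : 0 < κ) (hU : 0 ≤ U) :
    ∃ T : ℕ, ∀ f w : ℕ → ℝ, f 0 ≤ L → (∀ t, v ≤ f t) → Antitone f → (∀ t, w t ≤ f t) →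
      (∀ t, f t ≤ w t + U) →
      (∀ t, v + ε < f t → f (t + 1) ≤ f t - c ∨ (f (t + 1) = f t ∧ w t + κ ≤ w (t + 1))) →
      ∀ t, T ≤ t → f t ≤ v + ε := by
  obtain ⟨N, hN⟩ := exists_nat_gt (((U + κ) / c * (L - v) + U) / κ)
  rw [div_lt_iff₀ hκ] at hN
  refine ⟨N, fun f w hL hv hf hwf hfw hstep t ht => (hf ht).trans ?_⟩
  by_contra! hlt
  have hpot := potential_le_of_forall_step hc hκ.le hU hwf hfw fun t ht =>
    hstep t (hlt.trans_le (hf ht.le))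
  have hdrop := mul_le_mul_of_nonneg_left (sub_le_sub hL (hv N))
    (show 0 ≤ (U + κ) / c by positivity)
  linarith [hwf N, hfw 0]

end Potential

namespace SDP

variable {n m : ℕ} {D : SDP n m} {ρ α β : ℝ} {rp rc : ℕ} {Om0 : Matrix (Fin n) (Fin n) ℝ}

section UniformBounds

variable (β) (rp rc) (hOm0 : Om0.IsSymm) (hρ : 0 < ρ) (hα : 0 < α)

include hOm0 hρ hα

theorem exists_forall_F_Om_le (hβ : 0 ≤ β) (hne : D.affineSet.Nonempty) :
    ∃ L, ∀ R : D.Run ρ α β rp rc Om0, ∀ t, t ≠ 0 → D.F ρ (R.Om t) ≤ L := by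
  obtain ⟨X, hX⟩ := hne
  refine ⟨max (D.F ρ Om0) (D.F ρ X + (‖D.C‖ + ρ) * (‖X - Om0‖ + (‖D.C‖ + ρ) / α)),
    fun R t ht => ?_⟩
  induction t, Nat.one_le_iff_ne_zero.2 ht using Nat.le_induction with
  | base =>
    rcases R.Om_succ_eq_or 0 with hcand | ⟨-, -, hnull⟩
    · have hdist := R.norm_sub_cand_succ_le 0 hOm0 hρ hα hX
      rw [norm_sub_rev, R.Om_zero] at hdist
      rw [hcand]
      refine ((F_le_add_norm hρ.le (R.cand_mem 0).1 hX.1).trans ?_).trans (le_max_right _ _)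
      gcongr
    · rw [hnull, R.Om_zero]
      exact le_max_left _ _
  | succ t ht' ih =>
    have ht0 : t ≠ 0 := Nat.one_le_iff_ne_zero.1 ht'
    exact (R.F_Om_succ_le hOm0 hρ hα hβ (.inl ht0)).trans (ih ht0)

end UniformBounds

section Convergence

variable (β) (rp rc) (hS : D.Slater) (hρ : D.dualTraceMax < ρ) (hOm0 : Om0.IsSymm) (hα : 0 < α)

include hS hρ hOm0 hα

theorem exists_forall_norm_Om_le (hβ : 0 ≤ β) :
    ∃ B, 0 ≤ B ∧ ∀ R : D.Run ρ α β rp rc Om0, ∀ t, t ≠ 0 → ‖R.Om t‖ ≤ B := by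
  obtain ⟨X, hX, -⟩ := hS.1
  obtain ⟨L, hL⟩ :=
    exists_forall_F_Om_le β rp rc hOm0 (pos_of_dualTraceMax_lt hρ) hα hβ ⟨X, hX⟩
  obtain ⟨B, hB0, hB⟩ := exists_norm_le_of_F_le hS hρ L
  exact ⟨B, hB0, fun R t ht => hB _ (R.Om_mem_affineSet (.inl ht)) (hL R t ht)⟩

theorem exists_forall_F_Om_le_proxVal_add (hβ : 0 ≤ β) :
    ∃ U, 0 ≤ U ∧
      ∀ R : D.Run ρ α β rp rc Om0, ∀ t, t ≠ 0 → D.F ρ (R.Om t) ≤ R.proxVal t + U := by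
  have hρ0 := pos_of_dualTraceMax_lt hρ
  obtain ⟨X, hX, -⟩ := hS.1
  obtain ⟨L, hL⟩ := exists_forall_F_Om_le β rp rc hOm0 hρ0 hα hβ ⟨X, hX⟩
  obtain ⟨B, hB0, hB⟩ := exists_forall_norm_Om_le β rp rc hS hρ hOm0 hα hβ
  refine ⟨|L| + (‖D.C‖ + ρ) * ((‖D.C‖ + ρ) / α + B), by positivity, fun R t ht => ?_⟩
  have hcand : ‖R.cand (t + 1)‖ ≤ (‖D.C‖ + ρ) / α + B := by
    have hdist := R.norm_cand_succ_sub_Om_le t hOm0 hρ0 hα (.inl ht)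
    linarith [norm_sub_norm_le (R.cand (t + 1)) (R.Om t), hB R t ht]
  have hinner : |⟪D.C - R.W t, R.cand (t + 1)⟫_ℝ| ≤ (‖D.C‖ + ρ) * ((‖D.C‖ + ρ) / α + B) :=
    (abs_real_inner_le_norm _ _).trans
      (mul_le_mul (R.norm_C_sub_le (R.W_mem_weightSet t)) hcand (norm_nonneg _) (by positivity))
  have hsq : 0 ≤ α / 2 * ‖R.cand (t + 1) - R.Om t‖ ^ 2 := by positivity
  rw [Run.proxVal]
  linarith [hL R t ht, le_abs_self L, neg_le_of_abs_le hinner]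

/- The gain comes from moving the fraction `s` of the way towards a point `X` of low cost. -/
theorem exists_forall_le_F_Om_sub_proxVal (hβ : 0 ≤ β) {X : Matrix (Fin n) (Fin n) ℝ}
    (hX : X ∈ D.affineSet) {ε : ℝ} (hε : 0 < ε) :
    ∃ c, 0 < c ∧ ∀ R : D.Run ρ α β rp rc Om0, ∀ t, t ≠ 0 → D.F ρ X + ε ≤ D.F ρ (R.Om t) →
      c ≤ D.F ρ (R.Om t) - R.proxVal t := by
  obtain ⟨B, -, hB⟩ := exists_forall_norm_Om_le β rp rc hS hρ hOm0 hα hβ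
  set d := ‖X‖ + B
  set s := min 1 (ε / (α * d ^ 2 + 1))
  have hs0 : 0 < s := lt_min one_pos (by positivity)
  have hsd : s * (α * d ^ 2) ≤ ε := by
    have hle : s ≤ ε / (α * d ^ 2 + 1) := min_le_right _ _
    rw [le_div_iff₀ (by positivity)] at hle
    linarith
  refine ⟨s * ε / 2, by positivity, fun R t ht hfar => ?_⟩
  have hdist : ‖X - R.Om t‖ ≤ d := (norm_sub_le _ _).trans (add_le_add_right (hB R t ht) _)
  have hprox : α / 2 * (s * ‖X - R.Om t‖) ^ 2 ≤ s * ε / 2 :=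
    calc α / 2 * (s * ‖X - R.Om t‖) ^ 2 ≤ α / 2 * (s * d) ^ 2 := by gcongr
      _ = s / 2 * (s * (α * d ^ 2)) := by ring
      _ ≤ s / 2 * ε := by gcongr
      _ = s * ε / 2 := by ring
  have hval := R.proxVal_le_of_mem_Icc hOm0 (pos_of_dualTraceMax_lt hρ) hα (.inl ht) hX
    ⟨hs0.le, min_le_left _ _⟩
  have hgain : s * ε ≤ s * (D.F ρ (R.Om t) - D.F ρ X) := by gcongr; linarith
  linarith

theorem exists_forall_descent_or_proxVal_add_le (hrc : 0 < rc) (hβ : 0 < β) (hβ1 : β < 1)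
    {X : Matrix (Fin n) (Fin n) ℝ} (hX : X ∈ D.affineSet) {ε : ℝ} (hε : 0 < ε) :
    ∃ c κ, 0 < c ∧ 0 < κ ∧
      ∀ R : D.Run ρ α β rp rc Om0, ∀ t, t ≠ 0 → D.F ρ X + ε ≤ D.F ρ (R.Om t) →
        D.F ρ (R.Om (t + 1)) ≤ D.F ρ (R.Om t) - c ∨
          (R.Om (t + 1) = R.Om t ∧ R.proxVal t + κ ≤ R.proxVal (t + 1)) := by
  have hρ0 := pos_of_dualTraceMax_lt hρ
  obtain ⟨c, hc, hgain⟩ :=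
    exists_forall_le_F_Om_sub_proxVal β rp rc hS hρ hOm0 hα hβ.le hX hε
  have hτ : 0 < (1 - β) * c := mul_pos (sub_pos.2 hβ1) hc
  refine ⟨β * c, min ((1 - β) * c / 2) (α / 2 * ((1 - β) * c / (4 * (‖D.C‖ + ρ))) ^ 2),
    by positivity, by positivity, fun R t ht hfar => ?_⟩
  have hmodel : c ≤ D.F ρ (R.Om t) - D.model ρ (R.Wbar t) (R.P t) (R.cand (t + 1)) := by
    have hsq : 0 ≤ α / 2 * ‖R.cand (t + 1) - R.Om t‖ ^ 2 := by positivity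
    rw [R.model_cand_succ_eq_proxVal_sub hOm0 hρ0 hα]
    linarith [hgain R t ht hfar]
  by_cases hdesc : R.IsDescent t
  · have hdec : β * _ ≤ D.F ρ (R.Om t) - _ := hdesc
    rw [R.step_descent t (.inl ht) hdesc]
    exact .inl (by linarith [mul_le_mul_of_nonneg_left hmodel hβ.le])
  · have hinc : D.F ρ (R.Om t) - _ < β * _ := not_le.1 hdesc
    have hnull := R.step_null t (.inl ht) hdesc
    refine .inr ⟨hnull, R.proxVal_add_min_le_succ hOm0 hρ0 hα hrc hnull hτ ?_⟩
    linarith [mul_le_mul_of_nonneg_left hmodel (sub_nonneg.2 hβ1.le)]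

theorem exists_forall_F_Om_le_add (hrc : 0 < rc) (hβ : 0 < β) (hβ1 : β < 1)
    {q : (Fin m → ℝ) × Matrix (Fin n) (Fin n) ℝ} (hq : q ∈ D.dualOpt) {ε : ℝ} (hε : 0 < ε) :
    ∃ T : ℕ, 0 < T ∧ ∀ R : D.Run ρ α β rp rc Om0, ∀ t, T ≤ t →
      D.F ρ (R.Om t) ≤ D.b ⬝ᵥ q.1 + ε := by
  have hρ0 := pos_of_dualTraceMax_lt hρ
  obtain ⟨X, hX⟩ := primalOpt_nonempty hS
  obtain ⟨hXaff, hFX⟩ := (mem_primalOpt_iff hS hρ hq).1 hX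
  obtain ⟨L, hL⟩ := exists_forall_F_Om_le β rp rc hOm0 hρ0 hα hβ.le ⟨X, hXaff⟩
  obtain ⟨U, hU, hFU⟩ := exists_forall_F_Om_le_proxVal_add β rp rc hS hρ hOm0 hα hβ.le
  obtain ⟨c, κ, hc, hκ, hstep⟩ :=
    exists_forall_descent_or_proxVal_add_le β rp rc hS hρ hOm0 hα hrc hβ hβ1 hXaff hε
  obtain ⟨T, hT⟩ := exists_forall_le_of_potential (D.b ⬝ᵥ q.1) L ε hc hκ hU
  refine ⟨T + 1, T.succ_pos, fun R t ht => ?_⟩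
  have hconv := hT (fun t => D.F ρ (R.Om (t + 1))) (fun t => R.proxVal (t + 1))
    (hL R 1 one_ne_zero)
    (fun t => le_F hS.1 hρ hq (R.Om_mem_affineSet (.inl t.succ_ne_zero)))
    (antitone_nat_of_succ_le fun t => R.F_Om_succ_le hOm0 hρ0 hα hβ.le (.inl t.succ_ne_zero))
    (fun t => R.proxVal_le_F_Om hOm0 hρ0 hα (.inl t.succ_ne_zero))
    (fun t => hFU R _ t.succ_ne_zero)
    fun t hfar => (hstep R _ t.succ_ne_zero (by linarith)).imp_right fun h =>
      ⟨congrArg (D.F ρ) h.1, h.2⟩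
  simpa [Nat.sub_add_cancel (T.succ_pos.trans_le ht)] using hconv (t - 1) (Nat.le_sub_one_of_lt ht)

end Convergence

end SDP

/-! ### The quadratic upper bound -/

namespace SDP

variable {n m : ℕ} {D : SDP n m} {ρ : ℝ}

namespace Run

variable {α β : ℝ} {rp rc : ℕ} {Om0 : Matrix (Fin n) (Fin n) ℝ}
  {R : D.Run ρ α β rp rc Om0} {t : ℕ}

/-- The reference point `Ω_t` is feasible and `P_t` still represents `r_c` top eigenvectors of
`-Ω_t`, as is the case directly after a descent step. -/
def IsAnchored (R : D.Run ρ α β rp rc Om0) (t : ℕ) : Prop :=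
  (t ≠ 0 ∨ R.Om 0 ∈ D.affineSet) ∧ ∃ V : Matrix (Fin n) (Fin rc) ℝ,
    IsTopEigenvectors (-R.Om t) V ∧
      LinearMap.range V.mulVecLin ≤ LinearMap.range (R.P t).mulVecLin

theorem isAnchored_succ (h : R.Om (t + 1) = R.cand (t + 1)) : R.IsAnchored (t + 1) :=
  ⟨.inl t.succ_ne_zero, R.V t, h.symm ▸ R.V_eig t, R.P_span_current t⟩

theorem isAnchored_zero (h : R.Om 0 ∈ D.affineSet) : R.IsAnchored 0 := by
  have hP : IsTopEigenvectors (-R.Om 0) (R.P 0) := by rw [R.Om_zero]; exact R.P_zero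
  refine ⟨.inr h, _, hP.castLE (Nat.le_add_left rc rp), ?_⟩
  rw [range_mulVecLin, range_mulVecLin]
  exact Submodule.span_mono (Set.range_subset_iff.2 fun j => ⟨Fin.castLE _ j, rfl⟩)

theorem exists_le_isAnchored (ht : t ≠ 0 ∨ R.Om 0 ∈ D.affineSet) :
    ∃ s ≤ t, R.Om t = R.Om s ∧ R.IsAnchored s := by
  induction t with
  | zero => exact ⟨0, le_rfl, rfl, isAnchored_zero (by simpa using ht)⟩
  | succ t ih =>
    rcases R.Om_succ_eq_or t with hcand | ⟨ht', -, hnull⟩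
    · exact ⟨t + 1, le_rfl, rfl, isAnchored_succ hcand⟩
    · obtain ⟨s, hs, hOm, hanc⟩ := ih ht'
      exact ⟨s, hs.trans t.le_succ, hnull.trans hOm, hanc⟩

theorem isDescent_of_F_le_model_add (hOm0 : Om0.IsSymm) (hρ : 0 < ρ) (hα : 0 < α)
    (hβ : β ≤ 1 / 2) {η : ℝ} (hη : η ≤ α) (ht : t ≠ 0 ∨ R.Om 0 ∈ D.affineSet)
    (h : D.F ρ (R.cand (t + 1)) ≤ D.model ρ (R.Wbar t) (R.P t) (R.cand (t + 1)) +
      η / 2 * ‖R.cand (t + 1) - R.Om t‖ ^ 2) : R.IsDescent t := by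
  have hgain := R.mul_norm_sq_le_F_sub_model hOm0 hρ hα ht
  have hηα : η * ‖R.cand (t + 1) - R.Om t‖ ^ 2 ≤ α * ‖R.cand (t + 1) - R.Om t‖ ^ 2 := by gcongr
  have hhalf := mul_le_mul_of_nonneg_right hβ (le_trans (by positivity) hgain)
  rw [IsDescent]
  linarith

/- Anchored reference points of small cost are followed by descent steps only. -/
theorem isAnchored_of_F_le (hOm0 : Om0.IsSymm) (hρ : 0 < ρ) (hα : 0 < α) (hβ0 : 0 ≤ β)
    (hβ : β ≤ 1 / 2) {η : ℝ} (hη : η ≤ α) {c : ℝ}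
    (hquad : ∀ t, R.IsAnchored t → D.F ρ (R.Om t) ≤ c → ∀ X ∈ D.affineSet,
      D.F ρ X ≤ D.model ρ (R.Wbar t) (R.P t) X + η / 2 * ‖X - R.Om t‖ ^ 2)
    (ht : t ≠ 0 ∨ R.Om 0 ∈ D.affineSet) (hc : D.F ρ (R.Om t) ≤ c) : R.IsAnchored t := by
  obtain ⟨s, hst, hOm, hs⟩ := exists_le_isAnchored ht
  rw [hOm] at hc
  suffices h : R.IsAnchored t ∧ D.F ρ (R.Om t) ≤ c from h.1
  clear hOm ht
  induction t, hst using Nat.le_induction with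
  | base => exact ⟨hs, hc⟩
  | succ t _ ih =>
    obtain ⟨hanc, hF⟩ := ih
    have hdesc := isDescent_of_F_le_model_add hOm0 hρ hα hβ hη hanc.1
      (hquad t hanc hF _ (R.cand_mem t))
    exact ⟨isAnchored_succ (R.step_descent t hanc.1 hdesc),
      (R.F_Om_succ_le hOm0 hρ hα hβ0 hanc.1).trans hF⟩

theorem IsAnchored.F_le_model_add (hanc : R.IsAnchored t) (hρ : 0 ≤ ρ) (hrc : 0 < rc)
    (hrcn : rc < n) (hσ : D.sigmaP ≤ rc) {g : ℝ} (hg : 0 < g) {Xs : Matrix (Fin n) (Fin n) ℝ}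
    (hXs : Xs.IsSymm) (hsep : lam (-Xs) (D.sigmaP + 1) ≤ max (lam (-Xs) 1) 0 - g)
    (hnear : ‖R.Om t - Xs‖ ≤ g / 6) {X : Matrix (Fin n) (Fin n) ℝ} (hX : X.IsSymm) :
    D.F ρ X ≤ D.model ρ (R.Wbar t) (R.P t) X + 12 * ρ / g / 2 * ‖X - R.Om t‖ ^ 2 := by
  obtain ⟨ht, V, hV, hVP⟩ := hanc
  have hOm := (R.Om_mem_affineSet ht).1
  have hanti := lam_antitone hOm.neg hσ hrcn
  have hlow := le_of_abs_le (abs_lam_neg_sub_le hOm hXs (D.sigmaP + 1))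
  have htop := neg_le_of_abs_le ((abs_max_sub_max_le_abs (lam (-R.Om t) 1) (lam (-Xs) 1) 0).trans
    (abs_lam_neg_sub_le hOm hXs 1))
  have hsep' : lam (-R.Om t) (rc + 1) ≤ max (lam (-R.Om t) 1) 0 - 2 / 3 * g := by linarith
  have hconst : ρ * (4 / (2 / 3 * g)) = 12 * ρ / g / 2 := by field_simp; ring
  exact hconst ▸ SDP.F_le_model_add (R.isModelData t) hρ hrc hrcn hOm hX hV hVP (by positivity)
    hsep'

end Run

theorem le_etaConst (hρ : 0 ≤ ρ) (hgap : 0 < D.gap) : 12 * ρ / D.gap ≤ D.etaConst ρ :=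
  calc 12 * ρ / D.gap = 4 * ρ * (3 / D.gap) := by ring
    _ ≤ 4 * ρ * (9 * (8 * Real.sqrt 2 + 16) / D.gap) := by
      gcongr
      linarith [Real.sqrt_nonneg 2]
    _ ≤ D.etaConst ρ := mul_le_mul_of_nonneg_left (le_max_right _ _) (by positivity)

theorem exists_eta_forall_lam_sigmaP_le (hS : D.Slater) (hρ : D.dualTraceMax < ρ) :
    ∃ η, 0 < η ∧ (0 < D.gap → η = D.etaConst ρ) ∧
      (D.sigmaP < n → ∃ g, 0 < g ∧ 12 * ρ / g ≤ η ∧ (0 < D.gap → g = D.gap) ∧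
        ∀ X ∈ D.primalOpt, lam (-X) (D.sigmaP + 1) ≤ max (lam (-X) 1) 0 - g) := by
  have hρ0 := pos_of_dualTraceMax_lt hρ
  by_cases hgap : 0 < D.gap
  · have hη := le_etaConst hρ0.le hgap
    exact ⟨D.etaConst ρ, hη.trans_lt' (by positivity), fun _ => rfl, fun hσ =>
      ⟨D.gap, hgap, hη, fun _ => rfl, fun X hX => (lam_sigmaP_le_sub_gap hσ hX).trans
        (sub_le_sub_right (le_max_left _ _) _)⟩⟩
  by_cases hσ : D.sigmaP < n
  · obtain ⟨g, hg, hsep⟩ := exists_lam_sigmaP_le_neg hS hρ hσ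
    refine ⟨12 * ρ / g, by positivity, fun h => absurd h hgap, fun _ =>
      ⟨g, hg, le_rfl, fun h => absurd h hgap, fun X hX => (hsep X hX).trans ?_⟩⟩
    linarith [le_max_right (lam (-X) 1) 0]
  · exact ⟨1, one_pos, fun h => absurd h hgap, fun h => absurd h hσ⟩

theorem exists_forall_near_and_F_le_model_add (hS : D.Slater) (hρ : D.dualTraceMax < ρ) {g η : ℝ}
    (hg : 0 < g) (hη : 12 * ρ / g ≤ η)
    (hsep : ∀ X ∈ D.primalOpt, lam (-X) (D.sigmaP + 1) ≤ max (lam (-X) 1) 0 - g)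
    {rp rc : ℕ} (hrc : 0 < rc) (hrcn : rc < n) (hσ : D.sigmaP ≤ rc)
    {α β : ℝ} (hα : 0 < α) (hβ : 0 < β) (hβ1 : β < 1)
    {Om0 : Matrix (Fin n) (Fin n) ℝ} (hOm0 : Om0.IsSymm) :
    ∃ T : ℕ, 0 < T ∧ ∀ R : D.Run ρ α β rp rc Om0, ∀ t, T ≤ t →
      (∃ Xs ∈ D.primalOpt, ‖R.Om t - Xs‖ ≤ g / 6) ∧
      ((R.Om t = R.cand t ∨ (η ≤ α ∧ β ≤ 1 / 2)) → ∀ X ∈ D.affineSet,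
        D.F ρ X ≤ D.model ρ (R.Wbar t) (R.P t) X + η / 2 * ‖X - R.Om t‖ ^ 2) := by
  have hρ0 := pos_of_dualTraceMax_lt hρ
  obtain ⟨q, hq⟩ := dualOpt_nonempty hS
  obtain ⟨ε, hε, hnear⟩ := exists_forall_near_primalOpt hS hρ hq (show 0 < g / 6 by positivity)
  obtain ⟨T, hT, hconv⟩ := exists_forall_F_Om_le_add β rp rc hS hρ hOm0 hα hrc hβ hβ1 hq hε
  refine ⟨T, hT, fun R t ht => ?_⟩
  have ht0 : t ≠ 0 := by omega
  have hquad (t : ℕ) (hanc : R.IsAnchored t) (hF : D.F ρ (R.Om t) ≤ D.b ⬝ᵥ q.1 + ε)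
      (X : Matrix (Fin n) (Fin n) ℝ) (hX : X ∈ D.affineSet) :
      D.F ρ X ≤ D.model ρ (R.Wbar t) (R.P t) X + η / 2 * ‖X - R.Om t‖ ^ 2 := by
    obtain ⟨Xs, hXs, hd⟩ := hnear _ (R.Om_mem_affineSet hanc.1) hF
    refine (hanc.F_le_model_add hρ0.le hrc hrcn hσ hg hXs.1.1.1 (hsep Xs hXs) hd.le hX.1).trans ?_
    gcongr
  refine ⟨?_, fun h => hquad t ?_ (hconv R t ht)⟩
  · obtain ⟨Xs, hXs, hd⟩ := hnear _ (R.Om_mem_affineSet (.inl ht0)) (hconv R t ht)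
    exact ⟨Xs, hXs, hd.le⟩
  · rcases h with hcand | ⟨hηα, hβ2⟩
    · obtain ⟨s, rfl⟩ := Nat.exists_eq_succ_of_ne_zero ht0
      exact Run.isAnchored_succ hcand
    · exact Run.isAnchored_of_F_le hOm0 hρ0 hα hβ.le hβ2 hηα hquad (.inl ht0) (hconv R t ht)

end SDP

end SBMP

theorem mainTheorem8_general {n m : ℕ} (D : SBMP.SDP n m) (hSlater : D.Slater)
    (ρ : ℝ) (hρ : D.dualTraceMax < ρ) :
    ∃ η : ℝ, 0 < η ∧
      (D.C ∉ Submodule.span ℝ (Set.range D.A) → D.sigmaP < n → 0 < D.gap) ∧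
      (0 < D.gap → η = D.etaConst ρ) ∧
      ∀ rp rc : ℕ, 1 ≤ rc → rp + rc < n → D.sigmaP ≤ rc →
      ∀ α β : ℝ, 0 < α → 0 < β → β < 1 →
      ∀ Om0 : Matrix (Fin n) (Fin n) ℝ, Om0.IsSymm →
      ∃ T0 : ℕ, 0 < T0 ∧ ∀ R : D.Run ρ α β rp rc Om0, ∀ t : ℕ, T0 ≤ t →
        (0 < D.gap → ∃ Xs ∈ D.primalOpt, SBMP.opNorm (R.Om t - Xs) ≤ D.gap / 3) ∧
        (∀ X ∈ D.affineSet, D.model ρ (R.Wbar t) (R.P t) X ≤ D.F ρ X) ∧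
        ((R.Om t = R.cand t ∨ (η ≤ α ∧ β ≤ 1 / 2)) →
          ∀ X ∈ D.affineSet,
            D.F ρ X ≤ D.model ρ (R.Wbar t) (R.P t) X + η / 2 * SBMP.normSqF (X - R.Om t)) := by
  obtain ⟨η, hη, hηgap, hsep⟩ := SBMP.SDP.exists_eta_forall_lam_sigmaP_le hSlater hρ
  refine ⟨η, hη, SBMP.SDP.gap_pos hSlater hρ, hηgap,
    fun rp rc hrc hr hσ α β hα hβ hβ1 Om0 hOm0 => ?_⟩
  obtain ⟨g, hg, hgη, hgap, hsep⟩ := hsep (by omega)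
  obtain ⟨T, hT, hrun⟩ := SBMP.SDP.exists_forall_near_and_F_le_model_add (rp := rp) hSlater hρ hg
    hgη hsep hrc (by omega) hσ hα hβ hβ1 hOm0
  refine ⟨T, hT, fun R t ht => ⟨fun h => ?_, fun X hX => SBMP.SDP.model_le_F (R.isModelData t)
    (SBMP.SDP.pos_of_dualTraceMax_lt hρ).le hX.1, fun h X hX => ?_⟩⟩
  · obtain ⟨Xs, hXs, hd⟩ := (hrun R t ht).1
    refine ⟨Xs, hXs, (SBMP.opNorm_le_norm _).trans (hd.trans ?_)⟩
    linarith [hgap h]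
  · rw [SBMP.normSqF_eq_norm_sq]
    exact (hrun R t ht).2 h X hX

theorem mainTheorem8 {n m : ℕ} (D : SBMP.SDP n m)
    (hA : LinearIndependent ℝ D.A) (hSlater : D.Slater) (hsc : D.StrictComplementarity)
    (ρ : ℝ) (hρ : D.dualTraceMax < ρ) :
    ∃ η : ℝ, 0 < η ∧
      (D.C ∉ Submodule.span ℝ (Set.range D.A) → D.sigmaP < n → 0 < D.gap) ∧
      (0 < D.gap → η = D.etaConst ρ) ∧
      ∀ rp rc : ℕ, 1 ≤ rc → rp + rc < n → D.sigmaP ≤ rc →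
      ∀ α β : ℝ, 0 < α → 0 < β → β < 1 →
      ∀ Om0 : Matrix (Fin n) (Fin n) ℝ, Om0.IsSymm →
      ∃ T0 : ℕ, 0 < T0 ∧ ∀ R : D.Run ρ α β rp rc Om0, ∀ t : ℕ, T0 ≤ t →
        (0 < D.gap → ∃ Xs ∈ D.primalOpt, SBMP.opNorm (R.Om t - Xs) ≤ D.gap / 3) ∧
        (∀ X ∈ D.affineSet, D.model ρ (R.Wbar t) (R.P t) X ≤ D.F ρ X) ∧
        ((R.Om t = R.cand t ∨ (η ≤ α ∧ β ≤ 1 / 2)) →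
          ∀ X ∈ D.affineSet,
            D.F ρ X ≤ D.model ρ (R.Wbar t) (R.P t) X + η / 2 * SBMP.normSqF (X - R.Om t)) :=
  mainTheorem8_general D hSlater ρ hρ
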